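/- Fix a first-order vocabulary with infinitely many constants (and otherwise arbitrary function and predicate symbols). Formulas are built from atomic formulas with $\top,\bot,\land,\lor,\supset,\forall,\exists$ ($\top$ and $\bot$ are not atomic) and are identified up to renaming of bound variables. A sequent $\Gamma\longrightarrow\Delta$ is a pair of multisets of formulas; it is an axiom if $\top\in\Delta$, or if some $A$ that is atomic or $\bot$ lies in both $\Gamma$ and $\Delta$. The inference rules (upper sequents / lower sequent) are: - contr-L: $B,B,\Gamma\longrightarrow\Delta$ / $B,\Gamma\longrightarrow\Delta$; contr-R: $\Gamma\longrightarrow\Delta,B,B$ / $\Gamma\longrightarrow\Delta,B$; $\bot$-R: $\Gamma\longrightarrow\Delta,\bot$ / $\Gamma\longrightarrow\Delta,D$; - $\land$-L: $B,\Gamma\longrightarrow\Delta$ / $B\land D,\Gamma\longrightarrow\Delta$, and $D,\Gamma\longrightarrow\Delta$ / $B\land D,\Gamma\longrightarrow\Delta$; $\land$-R: $\Gamma\longrightarrow\Delta,B$ and $\Gamma\longrightarrow\Delta,D$ / $\Gamma\longrightarrow\Delta,B\land D$; - $\lor$-L: $B,\Gamma\longrightarrow\Delta$ and $D,\Gamma\longrightarrow\Delta$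 / $B\lor D,\Gamma\longrightarrow\Delta$; $\lor$-R: $\Gamma\longrightarrow\Delta,B$ / $\Gamma\longrightarrow\Delta,B\lor D$, and $\Gamma\longrightarrow\Delta,D$ / $\Gamma\longrightarrow\Delta,B\lor D$; - $\supset$-L: $\Gamma\longrightarrow\Delta,B$ and $D,\Gamma\longrightarrow\Theta$ / $B\supset D,\Gamma\longrightarrow\Delta,\Theta$; $\supset$-R: $B,\Gamma\longrightarrow\Delta,D$ / $\Gamma\longrightarrow\Delta,B\supset D$; - $\forall$-L: $[t/x]B,\Gamma\longrightarrow\Delta$ / $\forall x B,\Gamma\longrightarrow\Delta$; $\exists$-R: $\Gamma\longrightarrow\Delta,[t/x]B$ / $\Gamma\longrightarrow\Delta,\exists x B$ ($t$ any term); - $\exists$-L: $[c/x]B,\Gamma\longrightarrow\Delta$ / $\exists x B,\Gamma\longrightarrow\Delta$; $\forall$-R: $\Gamma\longrightarrow\Delta,[c/x]B$ / $\Gamma\longrightarrow\Delta,\forall x B$ ($c$ a constant that does not occur in the lower sequent). An **I**-proof is a derivation with these rules in which every sequent has exactly one formula in its succedent. An **O**-proof (uniform proof) is an **I**-proof in which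 every sequent whose succedent is a non-atomic formula $F\neq\bot$ is the lower sequent of an inference rule that introduces the top-level logical symbol of $F$ on the right; here an axiom $\Gamma\longrightarrow\top$ counts as introducing $\top$. Consider the following restrictions on the rules used in a proof: 1. $\forall$-R is not used. 2. $\lor$-R is not used or $\lor$-L is not used; and, in addition, either $\exists$-R is not used or neither $\lor$-L nor $\exists$-L is used. 3. Neither $\forall$-L nor $\supset$-R is used. **Theorem.** (a) Let $\Gamma$ be a multiset of formulas and $G$ a formula. If the sequent $G\supset\bot,\Gamma\longrightarrow G$ has an **I**-proof satisfying at least one of the restrictions 1, 2, 3, then the same sequent has an **O**-proof. (b) The characterization is complete, provided that the vocabulary contains a binary predicate symbol: for every set $U$ of inference rules that violates all three restrictions (that is, such that a proof using exactly the rules in $U$ would satisfy none of 1, 2, 3), there are $\Gamma$ and $G$ such that $G\supset\bot,\Gamma\longrightarrow G$ has an **I**-proof which uses only rules from $U$ and itself violates all three restrictions, but has no **O**-proof. -/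

import Mathlib

universe u v

namespace UniformProv

/-- Terms over the vocabulary `L` whose free variables are named by natural numbers and which may
also contain the `n` variables bound by enclosing quantifiers (the convention of Mathlib's
`FirstOrder.Language.BoundedFormula`). -/
abbrev Tm (L : FirstOrder.Language.{u, v}) (n : ℕ) : Type u := L.Term (ℕ ⊕ Fin n)

/-- First-order formulas (up to renaming of bound variables) with the primitive symbols
`⊤, ⊥, ∧, ∨, ⊃, ∀, ∃`. A member of `Fml L n` may contain `n` dangling bound variables; in
`all B` and `ex B` the quantified variable is the last variable `Fin.last n` of `B`. -/
inductive Fml (L : FirstOrder.Language.{u, v}) : ℕ → Type (max u v)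
  | top {n : ℕ} : Fml L n
  | bot {n : ℕ} : Fml L n
  | rel {n k : ℕ} (R : L.Relations k) (ts : Fin k → Tm L n) : Fml L n
  | and {n : ℕ} (B D : Fml L n) : Fml L n
  | or {n : ℕ} (B D : Fml L n) : Fml L n
  | imp {n : ℕ} (B D : Fml L n) : Fml L n
  | all {n : ℕ} (B : Fml L (n + 1)) : Fml L n
  | ex {n : ℕ} (B : Fml L (n + 1)) : Fml L n

/-- Proper formulas: no dangling bound variables. -/
abbrev Formula (L : FirstOrder.Language.{u, v}) : Type (max u v) := Fml L 0

section Syntactic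

variable {L : FirstOrder.Language.{u, v}}

/-- Apply to a term a substitution for the bound variables; free variables are unchanged. -/
def substTm {n m : ℕ} (σ : Fin n → Tm L m) (t : Tm L n) : Tm L m :=
  t.subst (Sum.elim (fun x => FirstOrder.Language.Term.var (Sum.inl x)) σ)

/-- Extend a substitution under a quantifier: the newly bound variable is kept. -/
def liftSubst {n m : ℕ} (σ : Fin n → Tm L m) : Fin (n + 1) → Tm L (m + 1) :=
  Fin.lastCases (FirstOrder.Language.Term.var (Sum.inr (Fin.last m)))
    (fun i => (σ i).relabel (Sum.map id Fin.castSucc))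

/-- Simultaneous substitution for the dangling bound variables of a formula. -/
def Fml.subst : {n m : ℕ} → (Fin n → Tm L m) → Fml L n → Fml L m
  | _, _, _, .top => .top
  | _, _, _, .bot => .bot
  | _, _, σ, .rel R ts => .rel R (fun i => substTm σ (ts i))
  | _, _, σ, .and B D => .and (B.subst σ) (D.subst σ)
  | _, _, σ, .or B D => .or (B.subst σ) (D.subst σ)
  | _, _, σ, .imp B D => .imp (B.subst σ) (D.subst σ)
  | _, _, σ, .all B => .all (B.subst (liftSubst σ))
  | _, _, σ, .ex B => .ex (B.subst (liftSubst σ))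

/-- `B.inst t` is `[t/x]B`, where `x` is the variable bound in `all B` or `ex B`. -/
def Fml.inst (B : Fml L 1) (t : Tm L 0) : Formula L := B.subst (fun _ => t)

/-- The constant `c` occurs in a term. -/
def TmHasConst (c : L.Constants) {α : Type} : L.Term α → Prop
  | .var _ => False
  | @FirstOrder.Language.Term.func _ _ k f ts =>
      (⟨k, f⟩ : Σ l, L.Functions l) = ⟨0, c⟩ ∨ ∃ i, TmHasConst c (ts i)

/-- The constant `c` occurs in a formula. -/
def Fml.HasConst (c : L.Constants) : {n : ℕ} → Fml L n → Prop
  | _, .top => False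
  | _, .bot => False
  | _, .rel _ ts => ∃ i, TmHasConst c (ts i)
  | _, .and B D => B.HasConst c ∨ D.HasConst c
  | _, .or B D => B.HasConst c ∨ D.HasConst c
  | _, .imp B D => B.HasConst c ∨ D.HasConst c
  | _, .all B => B.HasConst c
  | _, .ex B => B.HasConst c

/-- Atomic formulas; `⊤` and `⊥` are not atomic. -/
def Fml.IsAtomic {n : ℕ} (F : Fml L n) : Prop :=
  ∃ (k : ℕ) (R : L.Relations k) (ts : Fin k → Tm L n), F = .rel R ts

end Syntactic

/-- A sequent is a pair of multisets of formulas. -/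
structure Sequent (L : FirstOrder.Language.{u, v}) where
  ante : Multiset (Formula L)
  succ : Multiset (Formula L)

/-- Names of the inference rule schemata. -/
inductive Rule
  | contrL | contrR | botR
  | andL | orL | andR | orR | impL | impR
  | allL | exR | exL | allR

section Calculus

variable {L : FirstOrder.Language.{u, v}}

/-- Axioms: `⊤` is in the succedent, or `⊥` or some atomic formula is on both sides. -/
def Sequent.IsAxiom (s : Sequent L) : Prop :=
  .top ∈ s.succ ∨ ∃ A : Formula L, (A = .bot ∨ A.IsAtomic) ∧ A ∈ s.ante ∧ A ∈ s.succ

/-- The constant `c` does not appear in the formulas of the sequent. -/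
def Sequent.Fresh (c : L.Constants) (s : Sequent L) : Prop :=
  (∀ F ∈ s.ante, ¬ F.HasConst c) ∧ (∀ F ∈ s.succ, ¬ F.HasConst c)

/-- `Step1 r s₁ s`: an instance of the schema `r` with the single upper sequent `s₁` and the lower
sequent `s`. -/
inductive Step1 : Rule → Sequent L → Sequent L → Prop
  | contrL (B : Formula L) (Γ Δ : Multiset (Formula L)) :
      Step1 .contrL ⟨B ::ₘ B ::ₘ Γ, Δ⟩ ⟨B ::ₘ Γ, Δ⟩
  | contrR (B : Formula L) (Γ Δ : Multiset (Formula L)) :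
      Step1 .contrR ⟨Γ, B ::ₘ B ::ₘ Δ⟩ ⟨Γ, B ::ₘ Δ⟩
  | botR (D : Formula L) (Γ Δ : Multiset (Formula L)) :
      Step1 .botR ⟨Γ, .bot ::ₘ Δ⟩ ⟨Γ, D ::ₘ Δ⟩
  | andL_left (B D : Formula L) (Γ Δ : Multiset (Formula L)) :
      Step1 .andL ⟨B ::ₘ Γ, Δ⟩ ⟨.and B D ::ₘ Γ, Δ⟩
  | andL_right (B D : Formula L) (Γ Δ : Multiset (Formula L)) :
      Step1 .andL ⟨D ::ₘ Γ, Δ⟩ ⟨.and B D ::ₘ Γ, Δ⟩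
  | orR_left (B D : Formula L) (Γ Δ : Multiset (Formula L)) :
      Step1 .orR ⟨Γ, B ::ₘ Δ⟩ ⟨Γ, .or B D ::ₘ Δ⟩
  | orR_right (B D : Formula L) (Γ Δ : Multiset (Formula L)) :
      Step1 .orR ⟨Γ, D ::ₘ Δ⟩ ⟨Γ, .or B D ::ₘ Δ⟩
  | impR (B D : Formula L) (Γ Δ : Multiset (Formula L)) :
      Step1 .impR ⟨B ::ₘ Γ, D ::ₘ Δ⟩ ⟨Γ, .imp B D ::ₘ Δ⟩
  | allL (B : Fml L 1) (t : Tm L 0) (Γ Δ : Multiset (Formula L)) :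
      Step1 .allL ⟨B.inst t ::ₘ Γ, Δ⟩ ⟨.all B ::ₘ Γ, Δ⟩
  | exR (B : Fml L 1) (t : Tm L 0) (Γ Δ : Multiset (Formula L)) :
      Step1 .exR ⟨Γ, B.inst t ::ₘ Δ⟩ ⟨Γ, .ex B ::ₘ Δ⟩
  | exL (B : Fml L 1) (c : L.Constants) (Γ Δ : Multiset (Formula L))
      (hc : Sequent.Fresh c ⟨.ex B ::ₘ Γ, Δ⟩) :
      Step1 .exL ⟨B.inst c.term ::ₘ Γ, Δ⟩ ⟨.ex B ::ₘ Γ, Δ⟩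
  | allR (B : Fml L 1) (c : L.Constants) (Γ Δ : Multiset (Formula L))
      (hc : Sequent.Fresh c ⟨Γ, .all B ::ₘ Δ⟩) :
      Step1 .allR ⟨Γ, B.inst c.term ::ₘ Δ⟩ ⟨Γ, .all B ::ₘ Δ⟩

/-- `Step2 r s₁ s₂ s`: an instance of the schema `r` with the upper sequents `s₁`, `s₂` and the
lower sequent `s`. -/
inductive Step2 : Rule → Sequent L → Sequent L → Sequent L → Prop
  | orL (B D : Formula L) (Γ Δ : Multiset (Formula L)) :
      Step2 .orL ⟨B ::ₘ Γ, Δ⟩ ⟨D ::ₘ Γ, Δ⟩ ⟨.or B D ::ₘ Γ, Δ⟩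
  | andR (B D : Formula L) (Γ Δ : Multiset (Formula L)) :
      Step2 .andR ⟨Γ, B ::ₘ Δ⟩ ⟨Γ, D ::ₘ Δ⟩ ⟨Γ, .and B D ::ₘ Δ⟩
  | impL (B D : Formula L) (Γ Δ Θ : Multiset (Formula L)) :
      Step2 .impL ⟨Γ, B ::ₘ Δ⟩ ⟨D ::ₘ Γ, Θ⟩ ⟨.imp B D ::ₘ Γ, Δ + Θ⟩

/-- Derivations (**C**-proofs) of a sequent, as trees. -/
inductive Deriv : Sequent L → Type (max u v)
  | ax {s : Sequent L} (h : s.IsAxiom) : Deriv s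
  | one {s₁ s : Sequent L} (r : Rule) (h : Step1 r s₁ s) (d : Deriv s₁) : Deriv s
  | two {s₁ s₂ s : Sequent L} (r : Rule) (h : Step2 r s₁ s₂ s) (d₁ : Deriv s₁) (d₂ : Deriv s₂) :
      Deriv s

/-- The set of (names of) rules used in a derivation. -/
def Deriv.rules : {s : Sequent L} → Deriv s → Set Rule
  | _, .ax _ => ∅
  | _, .one r _ d => insert r d.rules
  | _, .two r _ d₁ d₂ => insert r (d₁.rules ∪ d₂.rules)

/-- **I**-proofs: every sequent of the derivation has exactly one formula in its succedent. -/
def Deriv.IsI : {s : Sequent L} → Deriv s → Prop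
  | s, .ax _ => s.succ.card = 1
  | s, .one _ _ d => s.succ.card = 1 ∧ d.IsI
  | s, .two _ _ d₁ d₂ => s.succ.card = 1 ∧ d₁.IsI ∧ d₂.IsI

/-- The schema `r` introduces the top-level logical symbol of `F` in the succedent. -/
def Rule.Introduces : Rule → Formula L → Prop
  | .andR, .and _ _ => True
  | .orR, .or _ _ => True
  | .impR, .imp _ _ => True
  | .allR, .all _ => True
  | .exR, .ex _ => True
  | _, _ => False

/-- Uniformity: a sequent with a non-atomic formula `F ≠ ⊥` in its succedent occurs only as the
lower sequent of a rule that introduces the top-level symbol of `F`. The symbol `⊤` is introduced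
by the axioms with `⊤` in the succedent and by nothing else. -/
def Deriv.IsUniform : {s : Sequent L} → Deriv s → Prop
  | s, .ax _ => ∀ F ∈ s.succ, F.IsAtomic ∨ F = .bot ∨ F = .top
  | s, .one r _ d => (∀ F ∈ s.succ, F.IsAtomic ∨ F = .bot ∨ r.Introduces F) ∧ d.IsUniform
  | s, .two r _ d₁ d₂ =>
      (∀ F ∈ s.succ, F.IsAtomic ∨ F = .bot ∨ r.Introduces F) ∧ d₁.IsUniform ∧ d₂.IsUniform

/-- **O**-proofs (uniform proofs). -/
def Deriv.IsO {s : Sequent L} (d : Deriv s) : Prop := d.IsI ∧ d.IsUniform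

/-- The sequent `G ⊃ ⊥, Γ ⟶ G`. -/
def augmented (Γ : Multiset (Formula L)) (G : Formula L) : Sequent L :=
  ⟨.imp G .bot ::ₘ Γ, {G}⟩

end Calculus

/-- First restriction on the set `U` of rules used. -/
def Restr1 (U : Set Rule) : Prop := Rule.allR ∉ U

/-- Second restriction on the set `U` of rules used. -/
def Restr2 (U : Set Rule) : Prop :=
  (Rule.orR ∉ U ∨ Rule.orL ∉ U) ∧ (Rule.exR ∉ U ∨ (Rule.orL ∉ U ∧ Rule.exL ∉ U))

/-- Third restriction on the set `U` of rules used. -/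
def Restr3 (U : Set Rule) : Prop := Rule.allL ∉ U ∧ Rule.impR ∉ U

end UniformProv

namespace UniformProv

open FirstOrder Language

variable {L : FirstOrder.Language.{u, v}}

/-! (a) An **I**-proof is first read in the calculus `Prov`: principal formulas on the left are
kept, so contraction and weakening become inclusion of contexts, and an eigenconstant rule has a
premise for every constant (`Deriv.prov`). `UProv` allows left rules at basic goals only. It yields
**O**-proofs (`Prov.oProv`), because `⊥`-R at a compound goal can be pushed up to basic goals. It
remains to pass from `Prov` to `UProv`.

Without `∀`-R, argue as for a double negation: by induction on the proof, if `F` refutes the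
context, meaning that a uniform proof of `F` in any extension gives one of `⊥`, then the context
proves `⊥` uniformly. Every left rule is then applied at the goal `⊥`. The assumption `G ⊃ ⊥` makes
`G` refute its context.

With neither `∀`-L nor `⊃`-R, saturate the context under the left rules while the goal is `⊥`. This
terminates because, without `∀`-L, each formula need be decomposed only once. In a saturated context
all left rules of the given proof are redundant, and the right rules that remain do not change the
context. They give a uniform proof of `G`, hence of `⊥`.

Under the second restriction left rules permute above right rules (`UProv.of_basic`). The only
obstruction is that premises of `∨`-L or `∃`-L may select different disjuncts or witnesses. The
restriction excludes this, except for `∃`-L with `∨`-R, where the choice made for a fresh constant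
serves for all constants.

(b) Let `H(x)` and `K(x)` be among `p(x,a) ∨ p(x,b)` and `∃ y, p(x,y)`. The goals are `∀ x, K(x)`
from `∀ x, H(x)`, or `∀ x, (H(x) ⊃ K(x))` from nothing. A uniform proof must select a disjunct or
witness of `K(c)` before it decomposes `H(c)`, and the atom it commits to is then unreachable. Using
`G ⊃ ⊥` merely restarts the search with a new constant. `not_blocked_of_isUniform` makes this an
invariant. -/

/-! ### Occurrence and renaming of constants -/

/-- The action of a renaming of the constants on all function symbols. -/
def renFn (ρ : L.Constants → L.Constants) : {k : ℕ} → L.Functions k → L.Functions k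
  | 0, f => ρ f
  | _ + 1, f => f

/-- Renaming of constants in a term. -/
def renTm (ρ : L.Constants → L.Constants) {α : Type} : L.Term α → L.Term α
  | .var x => .var x
  | .func f ts => .func (renFn ρ f) fun i => renTm ρ (ts i)

/-- Renaming of constants in a formula. -/
def Fml.ren (ρ : L.Constants → L.Constants) : {n : ℕ} → Fml L n → Fml L n
  | _, .top => .top
  | _, .bot => .bot
  | _, .rel R ts => .rel R fun i => renTm ρ (ts i)
  | _, .and B D => .and (B.ren ρ) (D.ren ρ)
  | _, .or B D => .or (B.ren ρ) (D.ren ρ)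
  | _, .imp B D => .imp (B.ren ρ) (D.ren ρ)
  | _, .all B => .all (B.ren ρ)
  | _, .ex B => .ex (B.ren ρ)

theorem renTm_const (ρ : L.Constants → L.Constants) {α : Type} (c : L.Constants) :
    renTm ρ (c.term : L.Term α) = (ρ c).term := by
  simp only [Constants.term, renTm, renFn]
  congr 1
  exact Subsingleton.elim _ _

theorem renTm_id {α : Type} (t : L.Term α) : renTm id t = t := by
  induction t with
  | var x => rfl
  | @func k f ts ih => cases k <;> simp [renTm, renFn, ih]

theorem Fml.ren_id {n : ℕ} (F : Fml L n) : F.ren id = F := by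
  induction F <;> simp_all [Fml.ren, renTm_id]

theorem renTm_congr {ρ ρ' : L.Constants → L.Constants} {α : Type} (t : L.Term α)
    (h : ∀ c, TmHasConst c t → ρ c = ρ' c) : renTm ρ t = renTm ρ' t := by
  induction t with
  | var x => rfl
  | @func k f ts ih =>
    simp only [TmHasConst] at h
    have hts : (fun i => renTm ρ (ts i)) = fun i => renTm ρ' (ts i) :=
      funext fun i => ih i fun c hc => h c (.inr ⟨i, hc⟩)
    have hf : renFn ρ f = renFn ρ' f := by
      cases k with
      | zero => exact h f (.inl rfl)
      | succ k => rfl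
    simp only [renTm, hts, hf]

theorem Fml.ren_congr {ρ ρ' : L.Constants → L.Constants} {n : ℕ} (F : Fml L n)
    (h : ∀ c, F.HasConst c → ρ c = ρ' c) : F.ren ρ = F.ren ρ' := by
  induction F with
  | top => rfl
  | bot => rfl
  | rel R ts =>
    simp only [Fml.ren]
    congr 1
    exact funext fun i => renTm_congr _ fun c hc => h c ⟨i, hc⟩
  | and B D hB hD | or B D hB hD | imp B D hB hD =>
    simp only [Fml.ren]
    rw [hB fun c hc => h c (.inl hc), hD fun c hc => h c (.inr hc)]
  | all B hB | ex B hB =>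
    simp only [Fml.ren]
    rw [hB fun c hc => h c hc]

open Classical in
theorem Fml.ren_update {ρ : L.Constants → L.Constants} {c c' : L.Constants} {n : ℕ} {F : Fml L n}
    (h : ¬ F.HasConst c) : F.ren (Function.update ρ c c') = F.ren ρ :=
  F.ren_congr fun d hd => Function.update_of_ne (by rintro rfl; exact h hd) _ _

theorem renTm_relabel (ρ : L.Constants → L.Constants) {α β : Type} (g : α → β) (t : L.Term α) :
    renTm ρ (t.relabel g) = (renTm ρ t).relabel g := by
  induction t with
  | var x => rfl
  | func f ts ih => simp [renTm, Term.relabel, ih]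

theorem renTm_substTm (ρ : L.Constants → L.Constants) {n m : ℕ} (σ : Fin n → Tm L m)
    (t : Tm L n) : renTm ρ (substTm σ t) = substTm (fun i => renTm ρ (σ i)) (renTm ρ t) := by
  unfold substTm
  induction t with
  | var x => rcases x with x | x <;> rfl
  | func f ts ih => simp [renTm, Term.subst, ih]

theorem renTm_liftSubst (ρ : L.Constants → L.Constants) {n m : ℕ} (σ : Fin n → Tm L m) :
    (fun i => renTm ρ (liftSubst σ i)) = liftSubst fun i => renTm ρ (σ i) := by
  funext i
  refine Fin.lastCases ?_ (fun i => ?_) i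
  · simp [liftSubst, renTm]
  · simp [liftSubst, renTm_relabel]

theorem Fml.ren_subst (ρ : L.Constants → L.Constants) {n m : ℕ} (F : Fml L n)
    (σ : Fin n → Tm L m) : (F.subst σ).ren ρ = (F.ren ρ).subst fun i => renTm ρ (σ i) := by
  induction F generalizing m with
  | top => rfl
  | bot => rfl
  | rel R ts => simp [Fml.subst, Fml.ren, renTm_substTm]
  | and B D hB hD | or B D hB hD | imp B D hB hD => simp [Fml.subst, Fml.ren, hB, hD]
  | all B hB | ex B hB => simp [Fml.subst, Fml.ren, hB, renTm_liftSubst]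

theorem Fml.ren_inst (ρ : L.Constants → L.Constants) (B : Fml L 1) (t : Tm L 0) :
    (B.inst t).ren ρ = (B.ren ρ).inst (renTm ρ t) :=
  B.ren_subst ρ _

open Classical in
theorem Fml.ren_update_inst {ρ : L.Constants → L.Constants} {c c' : L.Constants} {B : Fml L 1}
    (h : ¬ B.HasConst c) :
    (B.inst c.term).ren (Function.update ρ c c') = (B.ren ρ).inst c'.term := by
  rw [Fml.ren_inst, renTm_const, Function.update_self, Fml.ren_update h]

theorem finite_tmHasConst {α : Type} (t : L.Term α) : {c | TmHasConst c t}.Finite := by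
  induction t with
  | var x => simp [TmHasConst]
  | @func k f ts ih =>
    simp only [TmHasConst, Set.ofPred_or]
    refine Set.Finite.union ?_ (by simpa only [Set.ofPred_exists] using Set.finite_iUnion ih)
    refine Set.Subsingleton.finite fun c hc d hd => ?_
    have := hc.symm.trans hd
    simpa using this

theorem Fml.finite_hasConst {n : ℕ} (F : Fml L n) : {c | F.HasConst c}.Finite := by
  induction F with
  | top => simp [Fml.HasConst]
  | bot => simp [Fml.HasConst]
  | rel R ts =>
    simpa only [Fml.HasConst, Set.ofPred_exists] using
      Set.finite_iUnion fun i => finite_tmHasConst (ts i)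
  | and B D hB hD | or B D hB hD | imp B D hB hD =>
    simpa only [Fml.HasConst, Set.ofPred_or] using hB.union hD
  | all B hB | ex B hB => exact hB

theorem Sequent.exists_fresh [Infinite L.Constants] (s : Sequent L) : ∃ c, Sequent.Fresh c s := by
  have key (Γ : Multiset (Formula L)) : {c | ∃ F ∈ Γ, F.HasConst c}.Finite := by
    induction Γ using Multiset.induction with
    | empty => simp
    | cons F Γ ih =>
      simp only [Multiset.mem_cons, exists_eq_or_imp, Set.ofPred_or]
      exact F.finite_hasConst.union ih
  obtain ⟨c, hc⟩ := ((key s.ante).union (key s.succ)).exists_notMem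
  simp only [Set.mem_union, Set.mem_ofPred_eq, not_or, not_exists, not_and] at hc
  exact ⟨c, hc⟩

/-! ### The size of a formula -/

/-- The number of logical symbols, atomic formulas counting as `1`. -/
def Fml.size : {n : ℕ} → Fml L n → ℕ
  | _, .top => 1
  | _, .bot => 1
  | _, .rel _ _ => 1
  | _, .and B D => B.size + D.size + 1
  | _, .or B D => B.size + D.size + 1
  | _, .imp B D => B.size + D.size + 1
  | _, .all B => B.size + 1
  | _, .ex B => B.size + 1

theorem Fml.size_subst {n m : ℕ} (F : Fml L n) (σ : Fin n → Tm L m) :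
    (F.subst σ).size = F.size := by
  induction F generalizing m with
  | top => rfl
  | bot => rfl
  | rel R ts => rfl
  | and B D hB hD | or B D hB hD | imp B D hB hD => simp [Fml.subst, Fml.size, hB, hD]
  | all B hB | ex B hB => simp [Fml.subst, Fml.size, hB]

theorem Fml.size_inst (B : Fml L 1) (t : Tm L 0) : (B.inst t).size = B.size :=
  B.size_subst _

/-- Induction on formulas in which the bodies of quantified formulas are replaced by their
instances. -/
theorem Formula.inst_induction {P : Formula L → Prop} (top : P .top) (bot : P .bot)
    (rel : ∀ {k} (R : L.Relations k) ts, P (.rel R ts))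
    (and : ∀ B D, P B → P D → P (.and B D)) (or : ∀ B D, P B → P D → P (.or B D))
    (imp : ∀ B D, P B → P D → P (.imp B D)) (all : ∀ B, (∀ t, P (Fml.inst B t)) → P (.all B))
    (ex : ∀ B, (∀ t, P (Fml.inst B t)) → P (.ex B)) (F : Formula L) : P F := by
  induction hn : F.size using Nat.strong_induction_on generalizing F with
  | _ n ih =>
    subst hn
    match F, ih with
    | .top, _ => exact top
    | .bot, _ => exact bot
    | .rel R ts, _ => exact rel R ts
    | .and B D, ih =>
      exact and B D (ih _ (by simp [Fml.size]) B rfl) (ih _ (by simp [Fml.size]) D rfl)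
    | .or B D, ih =>
      exact or B D (ih _ (by simp [Fml.size]) B rfl) (ih _ (by simp [Fml.size]) D rfl)
    | .imp B D, ih =>
      exact imp B D (ih _ (by simp [Fml.size]) B rfl) (ih _ (by simp [Fml.size]) D rfl)
    | .all B, ih => exact all B fun t => ih _ (by simp [Fml.size, Fml.size_inst]) _ rfl
    | .ex B, ih => exact ex B fun t => ih _ (by simp [Fml.size, Fml.size_inst]) _ rfl

/-! ### A context-sharing calculus with one formula in the succedent -/

/-- The formulas that are atomic or `⊥`. -/
def Fml.IsBasic {n : ℕ} (F : Fml L n) : Prop := F = .bot ∨ F.IsAtomic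

/-- Intuitionistic provability in a calculus in which the principal formulas on the left are kept
and the rules with an eigenconstant have a premise for every constant. Only rules from `U` may be
used (for the rules that matter), and left rules only when the succedent satisfies `good`. -/
inductive Prov (U : Set Rule) (good : Formula L → Prop) :
    Multiset (Formula L) → Formula L → Prop
  | top (Γ) : Prov U good Γ .top
  | ax {Γ A} (hA : A.IsBasic) (h : A ∈ Γ) : Prov U good Γ A
  | botR {Γ} (D) (p : Prov U good Γ .bot) : Prov U good Γ D
  | andR {Γ B D} (p : Prov U good Γ B) (q : Prov U good Γ D) : Prov U good Γ (.and B D)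
  | orR_left {Γ B D} (hU : .orR ∈ U) (p : Prov U good Γ B) : Prov U good Γ (.or B D)
  | orR_right {Γ B D} (hU : .orR ∈ U) (p : Prov U good Γ D) : Prov U good Γ (.or B D)
  | impR {Γ B D} (hU : .impR ∈ U) (p : Prov U good (B ::ₘ Γ) D) : Prov U good Γ (.imp B D)
  | allR {Γ B} (hU : .allR ∈ U) (p : ∀ c : L.Constants, Prov U good Γ (Fml.inst B c.term)) :
      Prov U good Γ (.all B)
  | exR {Γ B} (hU : .exR ∈ U) (t) (p : Prov U good Γ (Fml.inst B t)) : Prov U good Γ (.ex B)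
  | andL {Γ F B D} (hF : good F) (h : .and B D ∈ Γ) (p : Prov U good (B ::ₘ D ::ₘ Γ) F) :
      Prov U good Γ F
  | orL {Γ F B D} (hU : .orL ∈ U) (hF : good F) (h : .or B D ∈ Γ) (p : Prov U good (B ::ₘ Γ) F)
      (q : Prov U good (D ::ₘ Γ) F) : Prov U good Γ F
  | impL {Γ F B D} (hF : good F) (h : .imp B D ∈ Γ) (p : Prov U good Γ B)
      (q : Prov U good (D ::ₘ Γ) F) : Prov U good Γ F
  | allL {Γ F B} (hU : .allL ∈ U) (hF : good F) (h : .all B ∈ Γ) (t)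
      (p : Prov U good (Fml.inst B t ::ₘ Γ) F) : Prov U good Γ F
  | exL {Γ F B} (hU : .exL ∈ U) (hF : good F) (h : .ex B ∈ Γ)
      (p : ∀ c : L.Constants, Prov U good (Fml.inst B c.term ::ₘ Γ) F) : Prov U good Γ F

theorem Fml.IsBasic.ren {n : ℕ} {F : Fml L n} (h : F.IsBasic) (ρ : L.Constants → L.Constants) :
    (F.ren ρ).IsBasic := by
  rcases h with rfl | ⟨k, R, ts, rfl⟩
  · exact .inl rfl
  · exact .inr ⟨k, R, _, rfl⟩

/-- Renaming of constants sends every member of `Γ` to a member of `Δ`. -/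
def RenSub (ρ : L.Constants → L.Constants) (Γ Δ : Multiset (Formula L)) : Prop :=
  ∀ F ∈ Γ, F.ren ρ ∈ Δ

theorem RenSub.cons {ρ : L.Constants → L.Constants} {Γ Δ : Multiset (Formula L)}
    (h : RenSub ρ Γ Δ) {F F' : Formula L} (hF : F.ren ρ = F') : RenSub ρ (F ::ₘ Γ) (F' ::ₘ Δ) := by
  intro A hA
  rcases Multiset.mem_cons.1 hA with rfl | hA
  · simp [hF]
  · exact Multiset.mem_cons_of_mem (h A hA)

theorem RenSub.mono {ρ : L.Constants → L.Constants} {Γ Δ Δ' : Multiset (Formula L)}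
    (h : RenSub ρ Γ Δ) (h' : Δ ⊆ Δ') : RenSub ρ Γ Δ' :=
  fun F hF => h' (h F hF)

open Classical in
theorem RenSub.update {ρ : L.Constants → L.Constants} {Γ Δ : Multiset (Formula L)}
    (h : RenSub ρ Γ Δ) {c c' : L.Constants} (hc : ∀ F ∈ Γ, ¬ F.HasConst c) :
    RenSub (Function.update ρ c c') Γ Δ := by
  intro F hF
  rw [Fml.ren_update (hc F hF)]
  exact h F hF

section Prov

variable {U : Set Rule} {good : Formula L → Prop}

/-- The renaming need not be injective. For the premise at `c'` of an eigenconstant rule, the given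
premise at a fresh `c` is renamed with `ρ` redirected to send `c` to `c'`. -/
theorem Prov.ren [Infinite L.Constants] (hgood : ∀ ρ F, good F → good (F.ren ρ))
    {Γ : Multiset (Formula L)} {F : Formula L} (h : Prov U good Γ F)
    (ρ : L.Constants → L.Constants) (Δ : Multiset (Formula L)) (hρ : RenSub ρ Γ Δ) :
    Prov U good Δ (F.ren ρ) := by
  classical
  induction h generalizing ρ Δ with
  | top Γ => exact .top _
  | ax hA h => exact .ax (hA.ren ρ) (hρ _ h)
  | botR D _ ih => exact .botR _ (ih ρ Δ hρ)
  | andR _ _ ih₁ ih₂ => exact .andR (ih₁ ρ Δ hρ) (ih₂ ρ Δ hρ)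
  | orR_left hU _ ih => exact .orR_left hU (ih ρ Δ hρ)
  | orR_right hU _ ih => exact .orR_right hU (ih ρ Δ hρ)
  | impR hU _ ih => exact .impR hU (ih ρ _ (hρ.cons rfl))
  | @allR Γ B hU _ ih =>
    refine .allR hU fun c' => ?_
    obtain ⟨c, hc₁, hc₂⟩ := Sequent.exists_fresh ⟨Γ, {.all B}⟩
    have := ih c (Function.update ρ c c') Δ (hρ.update hc₁)
    rwa [Fml.ren_update_inst (hc₂ (.all B) (by simp))] at this
  | @exR Γ B hU t _ ih =>
    refine .exR hU (renTm ρ t) ?_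
    rw [← Fml.ren_inst]
    exact ih ρ Δ hρ
  | andL hF h _ ih => exact .andL (hgood _ _ hF) (hρ _ h) (ih ρ _ ((hρ.cons rfl).cons rfl))
  | orL hU hF h _ _ ih₁ ih₂ =>
    exact .orL hU (hgood _ _ hF) (hρ _ h) (ih₁ ρ _ (hρ.cons rfl)) (ih₂ ρ _ (hρ.cons rfl))
  | impL hF h _ _ ih₁ ih₂ =>
    exact .impL (hgood _ _ hF) (hρ _ h) (ih₁ ρ _ hρ) (ih₂ ρ _ (hρ.cons rfl))
  | allL hU hF h t _ ih =>
    exact .allL hU (hgood _ _ hF) (hρ _ h) (renTm ρ t) (ih ρ _ (hρ.cons (Fml.ren_inst _ _ _)))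
  | @exL Γ F B hU hF h _ ih =>
    refine .exL hU (hgood _ _ hF) (hρ _ h) fun c' => ?_
    obtain ⟨c, hc₁, hc₂⟩ := Sequent.exists_fresh ⟨Γ, {F}⟩
    have := ih c (Function.update ρ c c') _
      ((hρ.update hc₁).cons (Fml.ren_update_inst (hc₁ _ h)))
    rwa [Fml.ren_update (hc₂ F (by simp))] at this

theorem Prov.mono {Γ Δ : Multiset (Formula L)} {F : Formula L} (h : Prov U good Γ F)
    (hΔ : Γ ⊆ Δ) : Prov U good Δ F := by
  induction h generalizing Δ with
  | top Γ => exact .top _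
  | ax hA h => exact .ax hA (hΔ h)
  | botR D _ ih => exact .botR _ (ih hΔ)
  | andR _ _ ih₁ ih₂ => exact .andR (ih₁ hΔ) (ih₂ hΔ)
  | orR_left hU _ ih => exact .orR_left hU (ih hΔ)
  | orR_right hU _ ih => exact .orR_right hU (ih hΔ)
  | impR hU _ ih => exact .impR hU (ih (Multiset.cons_subset_cons hΔ))
  | allR hU _ ih => exact .allR hU fun c => ih c hΔ
  | exR hU t _ ih => exact .exR hU t (ih hΔ)
  | andL hF h _ ih =>
    exact .andL hF (hΔ h) (ih (Multiset.cons_subset_cons (Multiset.cons_subset_cons hΔ)))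
  | orL hU hF h _ _ ih₁ ih₂ =>
    exact .orL hU hF (hΔ h) (ih₁ (Multiset.cons_subset_cons hΔ))
      (ih₂ (Multiset.cons_subset_cons hΔ))
  | impL hF h _ _ ih₁ ih₂ => exact .impL hF (hΔ h) (ih₁ hΔ) (ih₂ (Multiset.cons_subset_cons hΔ))
  | allL hU hF h t _ ih => exact .allL hU hF (hΔ h) t (ih (Multiset.cons_subset_cons hΔ))
  | exL hU hF h _ ih => exact .exL hU hF (hΔ h) fun c => ih c (Multiset.cons_subset_cons hΔ)

end Prov

/-! ### From **I**-proofs to the context-sharing calculus -/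

theorem Deriv.IsI.card_succ {s : Sequent L} {d : Deriv s} (h : d.IsI) : s.succ.card = 1 := by
  cases d with
  | ax _ => exact h
  | one => exact h.1
  | two => exact h.1

theorem cons_eq_singleton {α : Type*} {a b : α} {s : Multiset α} (h : a ::ₘ s = {b}) :
    a = b ∧ s = 0 := by
  have hs : s = 0 := by
    have := congrArg Multiset.card h
    simpa using this
  subst hs
  exact ⟨Multiset.singleton_inj.1 h, rfl⟩

/-- A derivation supplies one eigenconstant where `Prov` asks for all constants, so the induction
carries an arbitrary renaming. Redirecting the eigenconstant to `c'` does not affect the lower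
sequent, by freshness. -/
theorem Deriv.prov_ren {U : Set Rule} {s : Sequent L} (d : Deriv s) (hI : d.IsI)
    (hd : d.rules ⊆ U) {F : Formula L} (hF : s.succ = {F}) (ρ : L.Constants → L.Constants)
    (Δ : Multiset (Formula L)) (hρ : RenSub ρ s.ante Δ) :
    Prov U (fun _ => True) Δ (F.ren ρ) := by
  classical
  induction d generalizing F ρ Δ with
  | @ax s h =>
    rcases h with h | ⟨A, hA, h₁, h₂⟩
    · rw [hF, Multiset.mem_singleton] at h
      subst h
      exact .top _
    · rw [hF, Multiset.mem_singleton] at h₂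
      subst h₂
      exact .ax (Fml.IsBasic.ren hA ρ) (hρ _ h₁)
  | one r h d ih =>
    have hr : r ∈ U := hd (Set.mem_insert _ _)
    replace ih := @ih hI.2 fun x hx => hd (Set.mem_insert_of_mem _ hx)
    have hcard := hI.2.card_succ
    cases h with
    | contrL B Γ =>
      exact ih hF ρ Δ fun A hA => hρ A (by simp_all)
    | contrR B Γ Θ => simp at hcard
    | botR D Γ Θ =>
      obtain ⟨rfl, rfl⟩ := cons_eq_singleton hF
      exact .botR _ (ih rfl ρ Δ hρ)
    | andL_left B D Γ Θ =>
      refine .andL trivial (hρ (.and B D) (by simp)) (ih hF ρ _ ?_)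
      exact RenSub.cons (fun A hA => Multiset.mem_cons_of_mem (hρ A (by simp [hA]))) rfl
    | andL_right B D Γ Θ =>
      refine .andL trivial (hρ (.and B D) (by simp)) (ih hF ρ _ ?_)
      exact (RenSub.cons (fun A hA => hρ A (by simp [hA])) rfl).mono (Multiset.subset_cons _ _)
    | orR_left B D Γ Θ =>
      obtain ⟨rfl, rfl⟩ := cons_eq_singleton hF
      exact .orR_left hr (ih rfl ρ Δ hρ)
    | orR_right B D Γ Θ =>
      obtain ⟨rfl, rfl⟩ := cons_eq_singleton hF
      exact .orR_right hr (ih rfl ρ Δ hρ)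
    | impR B D Γ Θ =>
      obtain ⟨rfl, rfl⟩ := cons_eq_singleton hF
      exact .impR hr (ih rfl ρ _ (RenSub.cons hρ rfl))
    | allL B t Γ Θ =>
      refine .allL hr trivial (hρ (.all B) (by simp)) (renTm ρ t) (ih hF ρ _ ?_)
      exact RenSub.cons (fun A hA => hρ A (by simp [hA])) (Fml.ren_inst _ _ _)
    | exR B t Γ Θ =>
      obtain ⟨rfl, rfl⟩ := cons_eq_singleton hF
      refine .exR hr (renTm ρ t) ?_
      rw [← Fml.ren_inst]
      exact ih rfl ρ Δ hρ
    | exL B c Γ Θ hc =>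
      refine .exL hr trivial (hρ (.ex B) (by simp)) fun c' => ?_
      have := ih hF (Function.update ρ c c') ((Fml.inst (B.ren ρ) c'.term) ::ₘ Δ)
        (RenSub.cons (fun A hA => ?_) (Fml.ren_update_inst (hc.1 (.ex B) (by simp))))
      · rwa [Fml.ren_update (hc.2 F (by simp_all))] at this
      · rw [Fml.ren_update (hc.1 A (by simp [hA]))]
        exact hρ A (by simp [hA])
    | allR B c Γ Θ hc =>
      obtain ⟨rfl, rfl⟩ := cons_eq_singleton hF
      refine .allR hr fun c' => ?_
      have := ih rfl (Function.update ρ c c') Δ (RenSub.update hρ hc.1)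
      rwa [Fml.ren_update_inst (hc.2 (.all B) (by simp))] at this
  | two r h d₁ d₂ ih₁ ih₂ =>
    have hr : r ∈ U := hd (Set.mem_insert _ _)
    replace ih₁ := @ih₁ hI.2.1 fun x hx => hd (Set.mem_insert_of_mem _ (.inl hx))
    replace ih₂ := @ih₂ hI.2.2 fun x hx => hd (Set.mem_insert_of_mem _ (.inr hx))
    have hcard := hI.2.1.card_succ
    cases h with
    | orL B D Γ Θ =>
      exact .orL hr trivial (hρ (.or B D) (by simp))
        (ih₁ hF ρ _ (RenSub.cons (fun A hA => hρ A (by simp [hA])) rfl))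
        (ih₂ hF ρ _ (RenSub.cons (fun A hA => hρ A (by simp [hA])) rfl))
    | andR B D Γ Θ =>
      obtain ⟨rfl, rfl⟩ := cons_eq_singleton hF
      exact .andR (ih₁ rfl ρ Δ hρ) (ih₂ rfl ρ Δ hρ)
    | impL B D Γ Θ Ξ =>
      -- The left premise has the antecedent of the implication in its succedent already, so nothing
      -- else fits there.
      have hΘ : Θ = 0 := by simpa using hcard
      subst hΘ
      exact .impL trivial (hρ (.imp B D) (by simp))
        (ih₁ rfl ρ _ fun A hA => hρ A (by simp [hA]))
        (ih₂ (by simpa using hF) ρ _ (RenSub.cons (fun A hA => hρ A (by simp [hA])) rfl))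

theorem Deriv.prov {s : Sequent L} (d : Deriv s) (hI : d.IsI) {F : Formula L}
    (hF : s.succ = {F}) : Prov d.rules (fun _ => True) s.ante F := by
  have := d.prov_ren hI subset_rfl hF id s.ante fun A hA => by rwa [Fml.ren_id]
  rwa [Fml.ren_id] at this

/-! ### From the context-sharing calculus to **O**-proofs -/

/-- Existence of an **O**-proof of a sequent with one formula in the succedent. -/
def OProv (Γ : Multiset (Formula L)) (F : Formula L) : Prop :=
  ∃ d : Deriv (⟨Γ, {F}⟩ : Sequent L), d.IsO

theorem OProv.one {r : Rule} {Γ Γ' : Multiset (Formula L)} {F F' : Formula L}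
    (h : Step1 r ⟨Γ', F' ::ₘ 0⟩ ⟨Γ, F ::ₘ 0⟩) (hF : F.IsBasic ∨ r.Introduces F) (p : OProv Γ' F') :
    OProv Γ F := by
  obtain ⟨d, hI, hU⟩ := p
  refine ⟨.one r h d, ⟨rfl, hI⟩, fun A hA => ?_, hU⟩
  obtain rfl := Multiset.mem_singleton.1 hA
  rcases hF with (h | h) | h <;> simp [h]

theorem OProv.two {r : Rule} {Γ Γ₁ Γ₂ : Multiset (Formula L)} {F F₁ F₂ : Formula L}
    (h : Step2 r ⟨Γ₁, F₁ ::ₘ 0⟩ ⟨Γ₂, F₂ ::ₘ 0⟩ ⟨Γ, F ::ₘ 0⟩)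
    (hF : F.IsBasic ∨ r.Introduces F) (p₁ : OProv Γ₁ F₁) (p₂ : OProv Γ₂ F₂) : OProv Γ F := by
  obtain ⟨d₁, hI₁, hU₁⟩ := p₁
  obtain ⟨d₂, hI₂, hU₂⟩ := p₂
  refine ⟨.two r h d₁ d₂, ⟨rfl, hI₁, hI₂⟩, fun A hA => ?_, hU₁, hU₂⟩
  obtain rfl := Multiset.mem_singleton.1 hA
  rcases hF with (h | h) | h <;> simp [h]

section OProv

variable {Γ : Multiset (Formula L)} {F : Formula L}

theorem OProv.top (Γ : Multiset (Formula L)) : OProv Γ .top :=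
  ⟨.ax (.inl (Multiset.mem_singleton_self _)), rfl, fun F hF => by simp_all⟩

theorem OProv.ax (hF : F.IsBasic) (h : F ∈ Γ) : OProv Γ F := by
  refine ⟨.ax (.inr ⟨F, hF, h, Multiset.mem_singleton_self _⟩), rfl, fun A hA => ?_⟩
  obtain rfl := Multiset.mem_singleton.1 hA
  rcases hF with h | h <;> simp [h]

/-- Contracting first lets the left rules keep their principal formula, as in `Prov`. -/
theorem OProv.contr {B : Formula L} (hF : F.IsBasic) (h : B ∈ Γ) (p : OProv (B ::ₘ Γ) F) :
    OProv Γ F := by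
  obtain ⟨Γ, rfl⟩ := Multiset.exists_cons_of_mem h
  exact .one (.contrL B Γ _) (.inl hF) p

theorem OProv.andL {B D : Formula L} (hF : F.IsBasic) (h : .and B D ∈ Γ)
    (p : OProv (B ::ₘ D ::ₘ Γ) F) : OProv Γ F := by
  refine .contr hF h (.contr hF (Multiset.mem_cons_self _ _) ?_)
  refine .one (.andL_right B D _ _) (.inl hF) ?_
  rw [Multiset.cons_swap]
  refine .one (.andL_left B D _ _) (.inl hF) p

theorem OProv.orL {B D : Formula L} (hF : F.IsBasic) (h : .or B D ∈ Γ)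
    (p : OProv (B ::ₘ Γ) F) (q : OProv (D ::ₘ Γ) F) : OProv Γ F :=
  .contr hF h (.two (.orL B D Γ _) (.inl hF) p q)

theorem OProv.impL {B D : Formula L} (hF : F.IsBasic) (h : .imp B D ∈ Γ)
    (p : OProv Γ B) (q : OProv (D ::ₘ Γ) F) : OProv Γ F :=
  .contr hF h (.two (.impL B D Γ 0 _) (.inl hF) p q)

theorem OProv.allL {B : Fml L 1} (hF : F.IsBasic) (h : .all B ∈ Γ) (t : Tm L 0)
    (p : OProv (B.inst t ::ₘ Γ) F) : OProv Γ F :=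
  .contr hF h (.one (.allL B t Γ _) (.inl hF) p)

theorem OProv.exL [Infinite L.Constants] {B : Fml L 1} (hF : F.IsBasic) (h : .ex B ∈ Γ)
    (p : ∀ c : L.Constants, OProv (B.inst c.term ::ₘ Γ) F) : OProv Γ F := by
  obtain ⟨c, hc⟩ := Sequent.exists_fresh (⟨.ex B ::ₘ Γ, {F}⟩ : Sequent L)
  exact .contr hF h (.one (.exL B c Γ _ hc) (.inl hF) (p c))

theorem OProv.botR (hF : F.IsBasic) (p : OProv Γ .bot) : OProv Γ F :=
  .one (.botR F Γ 0) (.inl hF) p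

theorem OProv.andR {B D : Formula L} (p : OProv Γ B) (q : OProv Γ D) : OProv Γ (.and B D) :=
  .two (.andR B D Γ 0) (.inr trivial) p q

theorem OProv.orR_left {B D : Formula L} (p : OProv Γ B) : OProv Γ (.or B D) :=
  .one (.orR_left B D Γ 0) (.inr trivial) p

theorem OProv.orR_right {B D : Formula L} (p : OProv Γ D) : OProv Γ (.or B D) :=
  .one (.orR_right B D Γ 0) (.inr trivial) p

theorem OProv.impR {B D : Formula L} (p : OProv (B ::ₘ Γ) D) : OProv Γ (.imp B D) :=
  .one (.impR B D Γ 0) (.inr trivial) p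

theorem OProv.exR {B : Fml L 1} (t : Tm L 0) (p : OProv Γ (B.inst t)) : OProv Γ (.ex B) :=
  .one (.exR B t Γ 0) (.inr trivial) p

theorem OProv.allR [Infinite L.Constants] {B : Fml L 1}
    (p : ∀ c : L.Constants, OProv Γ (B.inst c.term)) : OProv Γ (.all B) := by
  obtain ⟨c, hc⟩ := Sequent.exists_fresh (⟨Γ, {.all B}⟩ : Sequent L)
  exact .one (.allR B c Γ 0 hc) (.inr trivial) (p c)

/-- `⊥`-R breaks uniformity at compound goals, so the goal is decomposed by right rules, with
arbitrary disjuncts and witnesses, down to basic goals. The hypothesis covers extensions of the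
context because `⊃`-R enlarges it. -/
theorem OProv.exfalso [Infinite L.Constants] (F : Formula L) :
    ∀ Γ : Multiset (Formula L), (∀ Δ, Γ ⊆ Δ → OProv Δ .bot) → OProv Γ F := by
  induction F using Formula.inst_induction with
  | top => exact fun Γ _ => .top Γ
  | bot => exact fun Γ h => h Γ (Multiset.Subset.refl _)
  | rel R ts => exact fun Γ h => .botR (.inr ⟨_, R, ts, rfl⟩) (h Γ (Multiset.Subset.refl _))
  | and B D hB hD => exact fun Γ h => .andR (hB Γ h) (hD Γ h)
  | or B D hB hD => exact fun Γ h => .orR_left (hB Γ h)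
  | imp B D hB hD =>
    exact fun Γ h => .impR (hD _ fun Δ hΔ =>
      h Δ (Multiset.Subset.trans (Multiset.subset_cons _ _) hΔ))
  | all B hB => exact fun Γ h => .allR fun c => hB _ Γ h
  | ex B hB => exact fun Γ h => .exR (Classical.arbitrary L.Constants).term (hB _ Γ h)

theorem Prov.oProv [Infinite L.Constants] {U : Set Rule} (h : Prov U Fml.IsBasic Γ F)
    (Δ : Multiset (Formula L)) (hΔ : Γ ⊆ Δ) : OProv Δ F := by
  induction h generalizing Δ with
  | top Γ => exact .top _
  | ax hA h => exact .ax hA (hΔ h)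
  | botR D _ ih => exact .exfalso D Δ fun Δ' h => ih Δ' (Multiset.Subset.trans hΔ h)
  | andR _ _ ih₁ ih₂ => exact .andR (ih₁ Δ hΔ) (ih₂ Δ hΔ)
  | orR_left hU _ ih => exact .orR_left (ih Δ hΔ)
  | orR_right hU _ ih => exact .orR_right (ih Δ hΔ)
  | impR hU _ ih => exact .impR (ih _ (Multiset.cons_subset_cons hΔ))
  | allR hU _ ih => exact .allR fun c => ih c Δ hΔ
  | exR hU t _ ih => exact .exR t (ih Δ hΔ)
  | andL hF h _ ih =>
    exact .andL hF (hΔ h) (ih _ (Multiset.cons_subset_cons (Multiset.cons_subset_cons hΔ)))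
  | orL hU hF h _ _ ih₁ ih₂ =>
    exact .orL hF (hΔ h) (ih₁ _ (Multiset.cons_subset_cons hΔ))
      (ih₂ _ (Multiset.cons_subset_cons hΔ))
  | impL hF h _ _ ih₁ ih₂ =>
    exact .impL hF (hΔ h) (ih₁ Δ hΔ) (ih₂ _ (Multiset.cons_subset_cons hΔ))
  | allL hU hF h t _ ih => exact .allL hF (hΔ h) t (ih _ (Multiset.cons_subset_cons hΔ))
  | exL hU hF h _ ih => exact .exL hF (hΔ h) fun c => ih c _ (Multiset.cons_subset_cons hΔ)

end OProv

/-- Provability in the context-sharing calculus with left rules only at basic goals. -/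
abbrev UProv (U : Set Rule) : Multiset (Formula L) → Formula L → Prop :=
  Prov U Fml.IsBasic

theorem Fml.isBasic_bot {n : ℕ} : (Fml.bot : Fml L n).IsBasic := .inl rfl

theorem UProv.mono {U : Set Rule} {Γ Δ : Multiset (Formula L)} {F : Formula L} (h : UProv U Γ F)
    (hΔ : Γ ⊆ Δ) : UProv U Δ F :=
  Prov.mono h hΔ

theorem cons_subset_of_mem {α : Type*} {a : α} {s t : Multiset α} (ha : a ∈ t) (h : s ⊆ t) :
    a ::ₘ s ⊆ t :=
  Multiset.cons_subset.2 ⟨ha, h⟩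

/-! ### Proofs without `∀`-R -/

/-- In every extension of `Γ`, a uniform proof of `F` gives one of `⊥`. -/
def Refutes (Γ : Multiset (Formula L)) (F : Formula L) : Prop :=
  ∀ Δ, Γ ⊆ Δ → UProv Set.univ Δ F → UProv Set.univ Δ .bot

theorem Refutes.mono {Γ Δ : Multiset (Formula L)} {F : Formula L} (h : Refutes Γ F)
    (hΔ : Γ ⊆ Δ) : Refutes Δ F :=
  fun Δ' h' => h Δ' (Multiset.Subset.trans hΔ h')

theorem refutes_of_mem {Γ : Multiset (Formula L)} {G : Formula L} (h : .imp G .bot ∈ Γ) :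
    Refutes Γ G :=
  fun _ hΔ p => .impL Fml.isBasic_bot (hΔ h) p (.ax Fml.isBasic_bot (Multiset.mem_cons_self _ _))

/-- The refutation of `F` acts as a continuation: a right rule passes to its premise the refutation
"apply the rule, then refute `F`". Under `∀`-R this fails, since a single instance does not give
back the universal formula. -/
theorem Prov.uProv_bot_of_refutes {U : Set Rule} (hU : Rule.allR ∉ U)
    {Γ : Multiset (Formula L)} {F : Formula L} (h : Prov U (fun _ => True) Γ F)
    (Δ : Multiset (Formula L)) (hΔ : Γ ⊆ Δ) (hF : Refutes Δ F) : UProv Set.univ Δ .bot := by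
  induction h generalizing Δ with
  | top Γ => exact hF Δ (Multiset.Subset.refl _) (.top _)
  | ax hA h => exact hF Δ (Multiset.Subset.refl _) (.ax hA (hΔ h))
  | botR D _ ih => exact ih Δ hΔ fun _ _ p => p
  | andR _ _ ih₁ ih₂ =>
    refine ih₁ Δ hΔ fun Δ' hΔ' p => ih₂ Δ' (Multiset.Subset.trans hΔ hΔ') fun Δ'' hΔ'' q => ?_
    exact hF Δ'' (Multiset.Subset.trans hΔ' hΔ'') (.andR (p.mono hΔ'') q)
  | orR_left _ _ ih => exact ih Δ hΔ fun Δ' hΔ' p => hF Δ' hΔ' (.orR_left trivial p)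
  | orR_right _ _ ih => exact ih Δ hΔ fun Δ' hΔ' p => hF Δ' hΔ' (.orR_right trivial p)
  | @impR Γ B D _ _ ih =>
    -- `B ⊃ D` is proved by deriving `⊥` from `B`. There `D` is refuted, since a proof of `D`
    -- already gives `B ⊃ D` by weakening.
    refine hF Δ (Multiset.Subset.refl _) (.impR trivial (.botR D ?_))
    refine ih _ (Multiset.cons_subset_cons hΔ) fun Δ' hΔ' q => ?_
    exact hF Δ' (Multiset.Subset.trans (Multiset.subset_cons _ _) hΔ')
      (.impR trivial (q.mono (Multiset.subset_cons _ _)))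
  | allR h _ _ => exact absurd h hU
  | exR _ t _ ih => exact ih Δ hΔ fun Δ' hΔ' p => hF Δ' hΔ' (.exR trivial t p)
  | andL _ h _ ih =>
    exact .andL Fml.isBasic_bot (hΔ h) <|
      ih _ (Multiset.cons_subset_cons (Multiset.cons_subset_cons hΔ)) <|
        hF.mono (Multiset.Subset.trans (Multiset.subset_cons _ _) (Multiset.subset_cons _ _))
  | orL _ _ h _ _ ih₁ ih₂ =>
    exact .orL trivial Fml.isBasic_bot (hΔ h)
      (ih₁ _ (Multiset.cons_subset_cons hΔ) (hF.mono (Multiset.subset_cons _ _)))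
      (ih₂ _ (Multiset.cons_subset_cons hΔ) (hF.mono (Multiset.subset_cons _ _)))
  | impL _ h _ _ ih₁ ih₂ =>
    -- With `⊥` proved from `D`, any proof of `B` gives `⊥` by `⊃`-L; so `B` is refuted as well.
    have q := ih₂ _ (Multiset.cons_subset_cons hΔ) (hF.mono (Multiset.subset_cons _ _))
    exact ih₁ Δ hΔ fun Δ' hΔ' p =>
      .impL Fml.isBasic_bot (hΔ' (hΔ h)) p (q.mono (Multiset.cons_subset_cons hΔ'))
  | allL _ _ h t _ ih =>
    exact .allL trivial Fml.isBasic_bot (hΔ h) t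
      (ih _ (Multiset.cons_subset_cons hΔ) (hF.mono (Multiset.subset_cons _ _)))
  | exL _ _ h _ ih =>
    exact .exL trivial Fml.isBasic_bot (hΔ h) fun c =>
      ih c _ (Multiset.cons_subset_cons hΔ) (hF.mono (Multiset.subset_cons _ _))

/-! ### Proofs with neither `∀`-L nor `⊃`-R -/

/-- The invertible left rules, and `⊃`-L for implications with a provable antecedent, have been
applied to `F` within the context `Γ`. -/
def Handled (Γ : Multiset (Formula L)) : Formula L → Prop
  | .and B D => B ∈ Γ ∧ D ∈ Γ
  | .or B D => B ∈ Γ ∨ D ∈ Γ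
  | .imp B D => UProv Set.univ Γ B → D ∈ Γ
  | .ex B => ∃ c : L.Constants, B.inst c.term ∈ Γ
  | _ => True

/-- In a saturated context some premise of each left rule adds only formulas already present, so the
left rules can be deleted. `⊃`-R would enlarge the context and might destroy saturation. -/
theorem Prov.uProv_of_handled {U : Set Rule} (h₁ : Rule.allL ∉ U) (h₂ : Rule.impR ∉ U)
    {Γ Δ : Multiset (Formula L)} {F : Formula L} (h : Prov U (fun _ => True) Γ F)
    (hΔ : Γ ⊆ Δ) (hs : ∀ A ∈ Δ, Handled Δ A) : UProv Set.univ Δ F := by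
  induction h with
  | top Γ => exact .top _
  | ax hA h => exact .ax hA (hΔ h)
  | botR D _ ih => exact .botR _ (ih hΔ)
  | andR _ _ ih₁ ih₂ => exact .andR (ih₁ hΔ) (ih₂ hΔ)
  | orR_left _ _ ih => exact .orR_left trivial (ih hΔ)
  | orR_right _ _ ih => exact .orR_right trivial (ih hΔ)
  | impR h _ _ => exact absurd h h₂
  | allR _ _ ih => exact .allR trivial fun c => ih c hΔ
  | exR _ t _ ih => exact .exR trivial t (ih hΔ)
  | andL _ h _ ih =>
    obtain ⟨hB, hD⟩ := hs _ (hΔ h)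
    exact ih (cons_subset_of_mem hB (cons_subset_of_mem hD hΔ))
  | orL _ _ h _ _ ih₁ ih₂ =>
    rcases hs _ (hΔ h) with hB | hD
    · exact ih₁ (cons_subset_of_mem hB hΔ)
    · exact ih₂ (cons_subset_of_mem hD hΔ)
  | impL _ h _ _ ih₁ ih₂ => exact ih₂ (cons_subset_of_mem (hs _ (hΔ h) (ih₁ hΔ)) hΔ)
  | allL h _ _ _ _ _ => exact absurd h h₁
  | exL _ _ h _ ih =>
    obtain ⟨c, hc⟩ := hs _ (hΔ h)
    exact ih c (cons_subset_of_mem hc hΔ)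

/-- `F` is handled within `Γ`, and remains so when `Γ` is extended. -/
def Done (Γ : Multiset (Formula L)) (F : Formula L) : Prop :=
  ∀ Δ, Γ ⊆ Δ → Handled Δ F

theorem Done.mono {Γ Δ : Multiset (Formula L)} {F : Formula L} (h : Done Γ F) (hΔ : Γ ⊆ Δ) :
    Done Δ F :=
  fun Δ' h' => h Δ' (Multiset.Subset.trans hΔ h')

/-- It suffices to prove `⊥` uniformly from the contexts all members of which are handled.
The members of `Ξ` are those that still have to be handled. -/
theorem uProv_bot_of_handled (n : ℕ) :
    ∀ Ξ Γ : Multiset (Formula L), (Ξ.map Fml.size).sum ≤ n → (∀ A ∈ Γ, A ∈ Ξ ∨ Done Γ A) →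
      (∀ Δ, Γ ⊆ Δ → (∀ A ∈ Δ, Handled Δ A) → UProv Set.univ Δ .bot) →
      UProv Set.univ Γ .bot := by
  induction n with
  | zero =>
    intro Ξ Γ hn hΓ H
    refine H Γ (Multiset.Subset.refl _) fun A hA => ?_
    rcases hΓ A hA with h | h
    -- Sizes are positive, so a list `Ξ` of total size zero is empty.
    · have : A.size ≤ (Ξ.map Fml.size).sum :=
        Multiset.single_le_sum (by simp) _ (Multiset.mem_map_of_mem _ h)
      cases A <;> simp [Fml.size] at this <;> omega
    · exact h Γ (Multiset.Subset.refl _)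
  | succ n ih =>
    intro Ξ Γ hn hΓ H
    by_cases hs : ∀ A ∈ Γ, Handled Γ A
    · exact H Γ (Multiset.Subset.refl _) hs
    push Not at hs
    obtain ⟨A, hA, hAΓ⟩ := hs
    -- An implication is handled vacuously while its antecedent is unprovable, and may cease to be
    -- so later. It therefore stays in `Ξ` until its consequent is present.
    have hAΞ : A ∈ Ξ := (hΓ A hA).resolve_right fun h => hAΓ (h Γ (Multiset.Subset.refl _))
    obtain ⟨Ξ, rfl⟩ := Multiset.exists_cons_of_mem hAΞ
    simp only [Multiset.map_cons, Multiset.sum_cons] at hn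
    -- extend the context by `Θ`, after which `A` is handled and `Θ` remains to be handled
    have key (Θ : Multiset (Formula L)) (hΘ : (Θ.map Fml.size).sum < A.size)
        (hd : Done (Θ + Γ) A) : UProv Set.univ (Θ + Γ) .bot := by
      have hsub : Γ ⊆ Θ + Γ := fun x hx => Multiset.mem_add.2 (.inr hx)
      refine ih (Θ + Ξ) (Θ + Γ) (by simp only [Multiset.map_add, Multiset.sum_add]; omega) ?_
        fun Δ hΔ => H Δ (Multiset.Subset.trans hsub hΔ)
      intro x hx
      rcases Multiset.mem_add.1 hx with hx | hx
      · exact .inl (Multiset.mem_add.2 (.inl hx))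
      rcases hΓ x hx with h | h
      · rcases Multiset.mem_cons.1 h with rfl | h
        · exact .inr hd
        · exact .inl (Multiset.mem_add.2 (.inr h))
      · exact .inr (h.mono hsub)
    match A, hA, hAΓ, key with
    | .and B D, hA, _, key =>
      refine .andL Fml.isBasic_bot hA ?_
      have := key (B ::ₘ {D}) (by simp [Fml.size]) fun Δ hΔ => ⟨hΔ (by simp), hΔ (by simp)⟩
      simpa using this
    | .or B D, hA, _, key =>
      refine .orL trivial Fml.isBasic_bot hA ?_ ?_
      · exact key {B} (by simp [Fml.size]) fun Δ hΔ => .inl (hΔ (by simp))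
      · exact key {D} (by simp [Fml.size]) fun Δ hΔ => .inr (hΔ (by simp))
    | .imp B D, hA, hAΓ, key =>
      simp only [Handled, Classical.not_imp] at hAΓ
      refine .impL Fml.isBasic_bot hA hAΓ.1 ?_
      exact key {D} (by simp [Fml.size]) fun Δ hΔ _ => hΔ (by simp)
    | .ex B, hA, _, key =>
      refine .exL trivial Fml.isBasic_bot hA fun c => ?_
      exact key {B.inst c.term} (by simp [Fml.size, Fml.size_inst]) fun Δ hΔ => ⟨c, hΔ (by simp)⟩
    | .top, _, hAΓ, _ | .bot, _, hAΓ, _ | .rel _ _, _, hAΓ, _ | .all _, _, hAΓ, _ =>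
      exact absurd trivial hAΓ

/-! ### Proofs in which disjunctive and existential choices are not blocked -/

section Choice

variable {U : Set Rule} {Γ : Multiset (Formula L)}

theorem UProv.and_inv {B D : Formula L} (h : UProv U Γ (.and B D)) :
    UProv U Γ B ∧ UProv U Γ D := by
  cases h with
  | ax hA h => simp [Fml.IsBasic, Fml.IsAtomic] at hA
  | botR _ p => exact ⟨.botR _ p, .botR _ p⟩
  | andR p q => exact ⟨p, q⟩
  | _ => simp_all [Fml.IsBasic, Fml.IsAtomic]

/-- A compound goal can only come from its own right rule or from `⊥`-R, since left rules require
basic goals; hence the inversions. -/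
theorem UProv.or_inv {B D : Formula L} (h : UProv U Γ (.or B D)) :
    UProv U Γ .bot ∨ Rule.orR ∈ U ∧ (UProv U Γ B ∨ UProv U Γ D) := by
  cases h with
  | botR _ p => exact .inl p
  | orR_left hU p => exact .inr ⟨hU, .inl p⟩
  | orR_right hU p => exact .inr ⟨hU, .inr p⟩
  | _ => simp_all [Fml.IsBasic, Fml.IsAtomic]

theorem UProv.imp_inv {B D : Formula L} (h : UProv U Γ (.imp B D)) : UProv U (B ::ₘ Γ) D := by
  cases h with
  | botR _ p => exact .botR _ (p.mono (Multiset.subset_cons _ _))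
  | impR hU p => exact p
  | _ => simp_all [Fml.IsBasic, Fml.IsAtomic]

theorem UProv.all_inv {B : Fml L 1} (h : UProv U Γ (.all B)) (c : L.Constants) :
    UProv U Γ (B.inst c.term) := by
  cases h with
  | botR _ p => exact .botR _ p
  | allR hU p => exact p c
  | _ => simp_all [Fml.IsBasic, Fml.IsAtomic]

theorem UProv.ex_inv {B : Fml L 1} (h : UProv U Γ (.ex B)) :
    UProv U Γ .bot ∨ Rule.exR ∈ U ∧ ∃ t, UProv U Γ (B.inst t) := by
  cases h with
  | botR _ p => exact .inl p
  | exR hU t p => exact .inr ⟨hU, t, p⟩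
  | _ => simp_all [Fml.IsBasic, Fml.IsAtomic]

/-- A rule on the left with premises `Θ i, Γ ⟶ F` that is admissible for basic `F` is admissible
for all `F`, provided that disjuncts and witnesses can be chosen uniformly in `i`. -/
theorem UProv.of_basic [Infinite L.Constants] {ι : Type*} (Θ : ι → Formula L)
    (himp : Rule.impR ∈ U) (hall : Rule.allR ∈ U)
    (hor : Rule.orR ∈ U → ∀ Δ, Γ ⊆ Δ → ∀ B D : Formula L,
      (∀ i, UProv U (Θ i ::ₘ Δ) B ∨ UProv U (Θ i ::ₘ Δ) D) →
      (∀ i, UProv U (Θ i ::ₘ Δ) B) ∨ (∀ i, UProv U (Θ i ::ₘ Δ) D))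
    (hex : Rule.exR ∈ U → ∀ Δ, Γ ⊆ Δ → ∀ B : Fml L 1,
      (∀ i, ∃ t, UProv U (Θ i ::ₘ Δ) (B.inst t)) → ∃ t, ∀ i, UProv U (Θ i ::ₘ Δ) (B.inst t))
    (hbasic : ∀ Δ, Γ ⊆ Δ → ∀ F : Formula L, F.IsBasic → (∀ i, UProv U (Θ i ::ₘ Δ) F) → UProv U Δ F)
    (F : Formula L) : ∀ Δ, Γ ⊆ Δ → (∀ i, UProv U (Θ i ::ₘ Δ) F) → UProv U Δ F := by
  induction F using Formula.inst_induction with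
  | top => exact fun Δ _ _ => .top Δ
  | bot => exact fun Δ hΔ h => hbasic Δ hΔ _ Fml.isBasic_bot h
  | rel R ts => exact fun Δ hΔ h => hbasic Δ hΔ _ (.inr ⟨_, R, ts, rfl⟩) h
  | and B D hB hD =>
    exact fun Δ hΔ h => .andR (hB Δ hΔ fun i => (h i).and_inv.1) (hD Δ hΔ fun i => (h i).and_inv.2)
  | or B D hB hD =>
    intro Δ hΔ h
    by_cases hU : Rule.orR ∈ U
    · have h' : ∀ i, UProv U (Θ i ::ₘ Δ) B ∨ UProv U (Θ i ::ₘ Δ) D := fun i =>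
        (h i).or_inv.elim (fun p => .inl (.botR _ p)) fun p => p.2
      rcases hor hU Δ hΔ B D h' with h' | h'
      · exact .orR_left hU (hB Δ hΔ h')
      · exact .orR_right hU (hD Δ hΔ h')
    -- Without `∨`-R every premise must prove `⊥`, which is a basic goal.
    · exact .botR _ (hbasic Δ hΔ _ Fml.isBasic_bot fun i =>
        (h i).or_inv.resolve_right fun p => hU p.1)
  | imp B D hB hD =>
    intro Δ hΔ h
    refine .impR himp (hD _ (Multiset.Subset.trans hΔ (Multiset.subset_cons _ _)) fun i => ?_)
    rw [Multiset.cons_swap]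
    exact (h i).imp_inv
  | all B hB => exact fun Δ hΔ h => .allR hall fun c => hB _ Δ hΔ fun i => (h i).all_inv c
  | ex B hB =>
    intro Δ hΔ h
    by_cases hU : Rule.exR ∈ U
    · have h' : ∀ i, ∃ t, UProv U (Θ i ::ₘ Δ) (B.inst t) := fun i =>
        (h i).ex_inv.elim (fun p => ⟨(Classical.arbitrary L.Constants).term, .botR _ p⟩)
          fun p => p.2
      obtain ⟨t, ht⟩ := hex hU Δ hΔ B h'
      exact .exR hU t (hB t Δ hΔ ht)
    · exact .botR _ (hbasic Δ hΔ _ Fml.isBasic_bot fun i =>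
        (h i).ex_inv.resolve_right fun p => hU p.1)

/-- The case of `UProv.of_basic` with a single premise. -/
theorem UProv.of_basic_one [Infinite L.Constants] (A : Formula L)
    (himp : Rule.impR ∈ U) (hall : Rule.allR ∈ U)
    (hbasic : ∀ Δ, Γ ⊆ Δ → ∀ F : Formula L, F.IsBasic → UProv U (A ::ₘ Δ) F → UProv U Δ F)
    {F : Formula L} (h : UProv U (A ::ₘ Γ) F) : UProv U Γ F :=
  UProv.of_basic (fun _ : Unit => A) himp hall
    (fun _ _ _ _ _ h => (h ()).imp (fun p _ => p) fun p _ => p)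
    (fun _ _ _ _ h => (h ()).imp fun _ p _ => p)
    (fun Δ hΔ F hF h => hbasic Δ hΔ F hF (h ())) F Γ (Multiset.Subset.refl _) fun _ => h

open Classical in
/-- A uniform proof for one fresh constant gives uniform proofs for all constants. -/
theorem UProv.generalize [Infinite L.Constants] {B : Fml L 1} {F : Formula L} {c : L.Constants}
    (hc : Sequent.Fresh c ⟨.ex B ::ₘ Γ, {F}⟩) (h : UProv U (B.inst c.term ::ₘ Γ) F)
    (c' : L.Constants) : UProv U (B.inst c'.term ::ₘ Γ) F := by
  have := Prov.ren (fun ρ F hF => Fml.IsBasic.ren hF ρ) h (Function.update id c c')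
    (B.inst c'.term ::ₘ Γ) (RenSub.cons (RenSub.update
      (fun A hA => by rwa [Fml.ren_id]) fun A hA => hc.1 A (Multiset.mem_cons_of_mem hA)) ?_)
  · rwa [Fml.ren_update (hc.2 F (Multiset.mem_singleton_self _)), Fml.ren_id] at this
  · rw [Fml.ren_update_inst (hc.1 (.ex B) (Multiset.mem_cons_self _ _)), Fml.ren_id]

/-- `U` contains every rule, except that `∨`-R and `∃`-R belong to it only if they belong to `V`.
The permutation needs `⊃`-R and `∀`-R freely, but must not bring in new choices. -/
theorem Prov.uProv_of_restr2 [Infinite L.Constants] {V : Set Rule} (hV : Restr2 V)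
    (hU : ∀ r, r ∈ U ↔ ((r = .orR ∨ r = .exR) → r ∈ V)) {F : Formula L}
    (h : Prov V (fun _ => True) Γ F) : UProv U Γ F := by
  have hVU : ∀ r, r ∈ V → r ∈ U := fun r hr => (hU r).2 fun _ => hr
  have himp : Rule.impR ∈ U := by simp [hU]
  have hall : Rule.allR ∈ U := by simp [hU]
  have hor : Rule.orR ∈ U ↔ Rule.orR ∈ V := by simp [hU]
  have hex : Rule.exR ∈ U ↔ Rule.exR ∈ V := by simp [hU]
  have step {Γ Δ : Multiset (Formula L)} {A : Formula L} (h : Γ ⊆ Δ) : A ::ₘ Γ ⊆ A ::ₘ Δ :=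
    Multiset.cons_subset_cons h
  induction h with
  | top Γ => exact .top _
  | ax hA h => exact .ax hA h
  | botR D _ ih => exact .botR _ ih
  | andR _ _ ih₁ ih₂ => exact .andR ih₁ ih₂
  | orR_left h _ ih => exact .orR_left (hVU _ h) ih
  | orR_right h _ ih => exact .orR_right (hVU _ h) ih
  | impR _ _ ih => exact .impR himp ih
  | allR _ _ ih => exact .allR hall ih
  | exR h t _ ih => exact .exR (hVU _ h) t ih
  | @andL Γ F B D _ h _ ih =>
    -- The two conjuncts are discharged one at a time, each as a one-premise rule.
    have left : UProv U (D ::ₘ Γ) F := UProv.of_basic_one B himp hall (fun Δ hΔ A hA p =>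
      .andL hA (hΔ (Multiset.mem_cons_of_mem h)) (p.mono (step (Multiset.subset_cons _ _)))) ih
    exact UProv.of_basic_one D himp hall (fun Δ hΔ A hA p =>
      .andL hA (hΔ h) (p.mono (Multiset.subset_cons _ _))) left
  | @orL Γ F B D hr _ h _ _ ih₁ ih₂ =>
    have h₁ : Rule.orR ∉ V := hV.1.resolve_right fun h => h hr
    have h₂ : Rule.exR ∉ V := hV.2.resolve_right fun h => h.1 hr
    exact UProv.of_basic (fun b : Bool => cond b B D) himp hall
      (fun h => absurd (hor.1 h) h₁) (fun h => absurd (hex.1 h) h₂)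
      (fun Δ hΔ A hA p => .orL (hVU _ hr) hA (hΔ h) (p true) (p false)) F Γ
      (Multiset.Subset.refl _) fun b => by cases b <;> assumption
  | impL _ h _ _ ih₁ ih₂ =>
    exact UProv.of_basic_one _ himp hall (fun Δ hΔ A hA p => .impL hA (hΔ h) (ih₁.mono hΔ) p) ih₂
  | allL hr _ h t _ ih =>
    exact UProv.of_basic_one _ himp hall (fun Δ hΔ A hA p => .allL (hVU _ hr) hA (hΔ h) t p) ih
  | @exL Γ F B hr _ h _ ih =>
    have h₂ : Rule.exR ∉ V := hV.2.resolve_right fun h => h.2 hr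
    refine UProv.of_basic (fun c : L.Constants => B.inst c.term) himp hall (fun _ Δ _ C D p => ?_)
      (fun h => absurd (hex.1 h) h₂)
      (fun Δ hΔ A hA p => .exL (hVU _ hr) hA (hΔ h) p) F Γ (Multiset.Subset.refl _) ih
    -- The disjunct proved for a fresh constant is proved for every constant, by renaming.
    obtain ⟨c, hc⟩ := Sequent.exists_fresh (⟨.ex B ::ₘ Δ, {.or C D}⟩ : Sequent L)
    have hcCD := hc.2 _ (Multiset.mem_singleton_self _)
    simp only [Fml.HasConst, not_or] at hcCD
    rcases p c with p | p
    · exact .inl (UProv.generalize ⟨hc.1, fun A hA => by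
        rw [Multiset.mem_singleton.1 hA]; exact hcCD.1⟩ p)
    · exact .inr (UProv.generalize ⟨hc.1, fun A hA => by
        rw [Multiset.mem_singleton.1 hA]; exact hcCD.2⟩ p)

end Choice

/-! ### The sufficient conditions -/

theorem exists_isO_of_restr [Infinite L.Constants] {Γ : Multiset (Formula L)} {G : Formula L}
    (d : Deriv (augmented Γ G)) (hI : d.IsI)
    (h : Restr1 d.rules ∨ Restr2 d.rules ∨ Restr3 d.rules) :
    ∃ d' : Deriv (augmented Γ G), d'.IsO := by
  have p : Prov d.rules (fun _ => True) (.imp G .bot ::ₘ Γ) G := d.prov hI rfl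
  have hG : Refutes (.imp G .bot ::ₘ Γ) G := refutes_of_mem (Multiset.mem_cons_self _ _)
  suffices ∃ U, UProv U (.imp G .bot ::ₘ Γ) G from
    this.elim fun U q => q.oProv _ (Multiset.Subset.refl _)
  rcases h with h | h | h
  · exact ⟨Set.univ, .botR _ (p.uProv_bot_of_refutes h _ (Multiset.Subset.refl _) hG)⟩
  -- The assumption `G ⊃ ⊥` plays no role in this case.
  · exact ⟨{r | (r = .orR ∨ r = .exR) → r ∈ d.rules}, p.uProv_of_restr2 h fun _ => Iff.rfl⟩
  · refine ⟨Set.univ, .botR _ (uProv_bot_of_handled _ (.imp G .bot ::ₘ Γ) _ le_rfl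
      (fun A hA => .inl hA) fun Δ hΔ hs => ?_)⟩
    exact hG Δ hΔ (p.uProv_of_handled h.1 h.2 hΔ hs)

/-! ### The formulas of the counterexamples -/

/-- The formula `p(s, t)`. -/
def atom (p : L.Relations 2) {n : ℕ} (s t : Tm L n) : Fml L n := .rel p ![s, t]

/-- The formula `p(x, a) ∨ p(x, b)`. -/
def orBody (p : L.Relations 2) (a b : L.Constants) : Fml L 1 :=
  .or (atom p (Term.var (.inr 0)) a.term) (atom p (Term.var (.inr 0)) b.term)

/-- The formula `∃ y, p(x, y)`. -/
def exBody (p : L.Relations 2) : Fml L 1 :=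
  .ex (atom p (Term.var (.inr 0)) (Term.var (.inr 1)))

/-- The formula `p(s, y)`. -/
def exInner (p : L.Relations 2) (s : Tm L 0) : Fml L 1 :=
  atom p (s.relabel (Sum.map id Fin.castSucc)) (Term.var (.inr 0))

theorem substTm_const {n m : ℕ} (σ : Fin n → Tm L m) (c : L.Constants) :
    substTm σ (c.term : Tm L n) = c.term := by
  simp only [substTm, Constants.term, Term.subst]
  congr 1
  exact Subsingleton.elim _ _

theorem substTm_relabel (t : Tm L 0) (s : Tm L 0) :
    substTm (fun _ : Fin 1 => t) (s.relabel (Sum.map id Fin.castSucc)) = s := by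
  unfold substTm
  induction s with
  | var x =>
    rcases x with x | x
    · rfl
    · exact x.elim0
  | func f ts ih => simp [Term.subst, Term.relabel, ih]

theorem subst_atom (p : L.Relations 2) {n m : ℕ} (σ : Fin n → Tm L m) (s t : Tm L n) :
    (atom p s t).subst σ = atom p (substTm σ s) (substTm σ t) := by
  simp only [atom, Fml.subst]
  congr 1
  funext i
  fin_cases i <;> rfl

theorem orBody_inst (p : L.Relations 2) (a b : L.Constants) (s : Tm L 0) :
    (orBody p a b).inst s = .or (atom p s a.term) (atom p s b.term) := by
  simp only [orBody, Fml.inst, Fml.subst, subst_atom, substTm_const]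
  rfl

theorem exBody_inst (p : L.Relations 2) (s : Tm L 0) :
    (exBody p).inst s = .ex (exInner p s) := by
  simp only [exBody, exInner, Fml.inst, Fml.subst, subst_atom]
  rfl

theorem exInner_inst (p : L.Relations 2) (s t : Tm L 0) :
    (exInner p s).inst t = atom p s t := by
  simp only [exInner, Fml.inst, subst_atom, substTm_relabel]
  rfl

theorem atom_inj {p : L.Relations 2} {n : ℕ} {s t s' t' : Tm L n} :
    atom p s t = atom p s' t' ↔ s = s' ∧ t = t' := by
  refine ⟨fun h => ?_, fun h => by rw [h.1, h.2]⟩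
  simp only [atom, Fml.rel.injEq, heq_eq_eq, true_and] at h
  exact ⟨congrFun h 0, congrFun h 1⟩

theorem isBasic_atom (p : L.Relations 2) {n : ℕ} (s t : Tm L n) : (atom p s t).IsBasic :=
  .inr ⟨2, p, _, rfl⟩

theorem hasConst_atom_left (p : L.Relations 2) (c : L.Constants) {n : ℕ} (t : Tm L n) :
    (atom p c.term t).HasConst c :=
  ⟨0, .inl rfl⟩

theorem hasConst_atom_right (p : L.Relations 2) (c : L.Constants) {n : ℕ} (s : Tm L n) :
    (atom p s c.term).HasConst c :=
  ⟨1, .inl rfl⟩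

/-! ### Failure of uniform provability -/

/-- The formulas with which the counterexamples are built. -/
def IsChoice (p : L.Relations 2) (a b : L.Constants) (B : Fml L 1) : Prop :=
  B = orBody p a b ∨ B = exBody p

/-- The formulas that may arise on the left in the search for a uniform proof of `G`. -/
def Tame (p : L.Relations 2) (a b : L.Constants) (G F : Formula L) : Prop :=
  F = .imp G .bot ∨ (∃ B, IsChoice p a b B ∧ F = .all B) ∨
    (∃ B s, IsChoice p a b B ∧ F = B.inst s) ∨ ∃ s t, F = atom p s t

/-- The goals without uniform proof that may arise in the search for a uniform proof of `G`. -/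
def Blocked (p : L.Relations 2) (a b : L.Constants) (G : Formula L) (Γ : Multiset (Formula L))
    (F : Formula L) : Prop :=
  F = .bot ∨ F = G ∨ (∃ s t, F = atom p s t ∧ F ∉ Γ) ∨
    ∃ s, (∀ t, atom p s t ∉ Γ) ∧ ((∃ K, IsChoice p a b K ∧ F = K.inst s) ∨
      ∃ H K, IsChoice p a b H ∧ IsChoice p a b K ∧ F = .imp (H.inst s) (K.inst s))

section Blocked

variable {p : L.Relations 2} {a b : L.Constants} {G : Formula L}

theorem IsChoice.inst_ne_atom {B : Fml L 1} (hB : IsChoice p a b B) (s s' t : Tm L 0) :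
    B.inst s ≠ atom p s' t := by
  rcases hB with rfl | rfl
  · simp [orBody_inst, atom]
  · simp [exBody_inst, atom]

theorem IsChoice.not_isBasic_inst {B : Fml L 1} (hB : IsChoice p a b B) (s : Tm L 0) :
    ¬ (B.inst s).IsBasic := by
  rcases hB with rfl | rfl
  · simp [orBody_inst, Fml.IsBasic, Fml.IsAtomic]
  · simp [exBody_inst, Fml.IsBasic, Fml.IsAtomic]

/-- The succedents of the counterexamples. -/
def IsGoal (p : L.Relations 2) (a b : L.Constants) (G : Formula L) : Prop :=
  ∃ K, IsChoice p a b K ∧ (G = .all K ∨ ∃ H, IsChoice p a b H ∧ G = .all (.imp H K))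

theorem Tame.inst {B : Fml L 1} (hB : IsChoice p a b B) (s : Tm L 0) :
    Tame p a b G (B.inst s) :=
  .inr (.inr (.inl ⟨B, s, hB, rfl⟩))

theorem Tame.atom (s t : Tm L 0) : Tame p a b G (UniformProv.atom p s t) :=
  .inr (.inr (.inr ⟨s, t, rfl⟩))

theorem Blocked.basic {Γ : Multiset (Formula L)} {F : Formula L} (hG : IsGoal p a b G)
    (h : Blocked p a b G Γ F) (hF : F.IsBasic) :
    F = .bot ∨ ∃ s t, F = UniformProv.atom p s t ∧ F ∉ Γ := by
  rcases h with h | rfl | h | ⟨s, -, ⟨K, hK, rfl⟩ | ⟨H, K, hH, hK, rfl⟩⟩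
  · exact .inl h
  · obtain ⟨K, -, rfl | ⟨H, -, rfl⟩⟩ := hG <;> simp [Fml.IsBasic, Fml.IsAtomic] at hF
  · exact .inr h
  · exact absurd hF (hK.not_isBasic_inst s)
  · simp [Fml.IsBasic, Fml.IsAtomic] at hF

theorem Blocked.of_basic {Γ : Multiset (Formula L)} {F : Formula L}
    (h : F = .bot ∨ ∃ s t, F = UniformProv.atom p s t ∧ F ∉ Γ) : Blocked p a b G Γ F :=
  h.elim .inl fun h => .inr (.inr (.inl h))

theorem Tame.not_bot : ¬ Tame p a b G .bot := by
  rintro (h | ⟨B, -, h⟩ | ⟨B, s, rfl | rfl, h⟩ | ⟨s, t, h⟩)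
  · simp at h
  · simp at h
  · simp [orBody_inst] at h
  · simp [exBody_inst] at h
  · simp [UniformProv.atom] at h

theorem not_tame_and {B D : Formula L} : ¬ Tame p a b G (.and B D) := by
  rintro (h | ⟨B, -, h⟩ | ⟨B, s, rfl | rfl, h⟩ | ⟨s, t, h⟩)
  · simp at h
  · simp at h
  · simp [orBody_inst] at h
  · simp [exBody_inst] at h
  · simp [UniformProv.atom] at h

theorem Tame.or_inv {B D : Formula L} (h : Tame p a b G (.or B D)) :
    ∃ s, B = UniformProv.atom p s a.term ∧ D = UniformProv.atom p s b.term := by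
  rcases h with h | ⟨B, -, h⟩ | ⟨B, s, rfl | rfl, h⟩ | ⟨s, t, h⟩
  · simp at h
  · simp at h
  · rw [orBody_inst, Fml.or.injEq] at h
    exact ⟨s, h⟩
  · simp [exBody_inst] at h
  · simp [UniformProv.atom] at h

theorem Tame.imp_inv {B D : Formula L} (h : Tame p a b G (.imp B D)) : B = G := by
  rcases h with h | ⟨B, -, h⟩ | ⟨B, s, rfl | rfl, h⟩ | ⟨s, t, h⟩
  · rw [Fml.imp.injEq] at h
    exact h.1
  · simp at h
  · simp [orBody_inst] at h
  · simp [exBody_inst] at h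
  · simp [UniformProv.atom] at h

theorem Tame.all_inv {B : Fml L 1} (h : Tame p a b G (.all B)) : IsChoice p a b B := by
  rcases h with h | ⟨B, hB, h⟩ | ⟨B, s, rfl | rfl, h⟩ | ⟨s, t, h⟩
  · simp at h
  · rw [Fml.all.injEq] at h
    exact h ▸ hB
  · simp [orBody_inst] at h
  · simp [exBody_inst] at h
  · simp [UniformProv.atom] at h

theorem Tame.ex_inv {B : Fml L 1} (h : Tame p a b G (.ex B)) : ∃ s, B = exInner p s := by
  rcases h with h | ⟨B, -, h⟩ | ⟨B, s, rfl | rfl, h⟩ | ⟨s, t, h⟩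
  · simp at h
  · simp at h
  · simp [orBody_inst] at h
  · rw [exBody_inst, Fml.ex.injEq] at h
    exact ⟨s, h⟩
  · simp [UniformProv.atom] at h

theorem Blocked.not_and {Γ : Multiset (Formula L)} {B D : Formula L} (hG : IsGoal p a b G) :
    ¬ Blocked p a b G Γ (.and B D) := by
  rintro (h | rfl | ⟨s, t, h, -⟩ | ⟨s, -, ⟨K, rfl | rfl, h⟩ | ⟨H, K, -, -, h⟩⟩)
  · simp at h
  · obtain ⟨K, -, h | ⟨H, -, h⟩⟩ := hG <;> simp at h
  · simp [UniformProv.atom] at h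
  · simp [orBody_inst] at h
  · simp [exBody_inst] at h
  · simp at h

theorem Blocked.not_top {Γ : Multiset (Formula L)} (hG : IsGoal p a b G) :
    ¬ Blocked p a b G Γ .top := by
  rintro (h | rfl | ⟨s, t, h, -⟩ | ⟨s, -, ⟨K, rfl | rfl, h⟩ | ⟨H, K, -, -, h⟩⟩)
  · simp at h
  · obtain ⟨K, -, h | ⟨H, -, h⟩⟩ := hG <;> simp at h
  · simp [UniformProv.atom] at h
  · simp [orBody_inst] at h
  · simp [exBody_inst] at h
  · simp at h

theorem Blocked.or_inv {Γ : Multiset (Formula L)} {B D : Formula L} (hG : IsGoal p a b G)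
    (h : Blocked p a b G Γ (.or B D)) : Blocked p a b G Γ B ∧ Blocked p a b G Γ D := by
  rcases h with h | rfl | ⟨s, t, h, -⟩ | ⟨s, hs, ⟨K, rfl | rfl, h⟩ | ⟨H, K, -, -, h⟩⟩
  · simp at h
  · obtain ⟨K, -, h | ⟨H, -, h⟩⟩ := hG <;> simp at h
  · simp [UniformProv.atom] at h
  · rw [orBody_inst, Fml.or.injEq] at h
    obtain ⟨rfl, rfl⟩ := h
    exact ⟨.of_basic (.inr ⟨s, _, rfl, hs _⟩), .of_basic (.inr ⟨s, _, rfl, hs _⟩)⟩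
  · simp [exBody_inst] at h
  · simp at h

theorem Blocked.ex_inv {Γ : Multiset (Formula L)} {B : Fml L 1} (hG : IsGoal p a b G)
    (h : Blocked p a b G Γ (.ex B)) (t : Tm L 0) : Blocked p a b G Γ (B.inst t) := by
  rcases h with h | rfl | ⟨s, t, h, -⟩ | ⟨s, hs, ⟨K, rfl | rfl, h⟩ | ⟨H, K, -, -, h⟩⟩
  · simp at h
  · obtain ⟨K, -, h | ⟨H, -, h⟩⟩ := hG <;> simp at h
  · simp [UniformProv.atom] at h
  · simp [orBody_inst] at h
  · rw [exBody_inst, Fml.ex.injEq] at h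
    subst h
    rw [exInner_inst]
    exact .of_basic (.inr ⟨s, _, rfl, hs _⟩)
  · simp at h

/-- The new assumption `H(s)` is not an atom, so still no `p(s, t)` is in the context. -/
theorem Blocked.imp_inv {Γ : Multiset (Formula L)} {B D : Formula L} (hG : IsGoal p a b G)
    (h : Blocked p a b G Γ (.imp B D)) :
    Tame p a b G B ∧ Blocked p a b G (B ::ₘ Γ) D := by
  rcases h with h | rfl | ⟨s, t, h, -⟩ | ⟨s, hs, ⟨K, rfl | rfl, h⟩ | ⟨H, K, hH, hK, h⟩⟩
  · simp at h
  · obtain ⟨K, -, h | ⟨H, -, h⟩⟩ := hG <;> simp at h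
  · simp [UniformProv.atom] at h
  · simp [orBody_inst] at h
  · simp [exBody_inst] at h
  · rw [Fml.imp.injEq] at h
    obtain ⟨rfl, rfl⟩ := h
    refine ⟨.inst hH s, .inr (.inr (.inr ⟨s, fun t ht => ?_, .inl ⟨K, hK, rfl⟩⟩))⟩
    rcases Multiset.mem_cons.1 ht with ht | ht
    · exact hH.inst_ne_atom _ _ _ ht.symm
    · exact hs t ht

/-- The eigenconstant is new to the context, so no `p(c, t)` can occur there. -/
theorem Blocked.all_inv {Γ : Multiset (Formula L)} {B : Fml L 1} (hG : IsGoal p a b G)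
    (h : Blocked p a b G Γ (.all B)) {c : L.Constants} (hc : ∀ F ∈ Γ, ¬ F.HasConst c) :
    Blocked p a b G Γ (B.inst c.term) := by
  rcases h with h | rfl | ⟨s, t, h, -⟩ | ⟨s, -, ⟨K, rfl | rfl, h⟩ | ⟨H, K, -, -, h⟩⟩
  · simp at h
  · have hs : ∀ t, UniformProv.atom p c.term t ∉ Γ := fun t ht =>
      hc _ ht (hasConst_atom_left p c t)
    refine .inr (.inr (.inr ⟨c.term, hs, ?_⟩))
    obtain ⟨K, hK, h | ⟨H, hH, h⟩⟩ := hG <;> rw [Fml.all.injEq] at h <;> subst h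
    · exact .inl ⟨_, hK, rfl⟩
    · exact .inr ⟨H, K, hH, hK, rfl⟩
  · simp [UniformProv.atom] at h
  · simp [orBody_inst] at h
  · simp [exBody_inst] at h
  · simp at h

/-- Each rule that can end a uniform proof of a blocked goal from tame assumptions has a premise of
the same kind, and no axiom is of this kind. Left rules meet only `⊥` or an absent atom as goal. -/
theorem not_blocked_of_isUniform (hab : a ≠ b) (hG : IsGoal p a b G) {s : Sequent L}
    (d : Deriv s) (hI : d.IsI) (hU : d.IsUniform) {F : Formula L} (hF : s.succ = {F})
    (hΓ : ∀ A ∈ s.ante, Tame p a b G A) : ¬ Blocked p a b G s.ante F := by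
  induction d generalizing F with
  | @ax s h =>
    intro hB
    rcases h with h | ⟨A, hA, h₁, h₂⟩
    · rw [hF, Multiset.mem_singleton] at h
      subst h
      exact Blocked.not_top hG hB
    · rw [hF, Multiset.mem_singleton] at h₂
      subst h₂
      rcases hB.basic hG hA with rfl | ⟨s, t, -, h⟩
      · exact Tame.not_bot (hΓ _ h₁)
      · exact h h₁
  | @one s₁ s r h d ih =>
    intro hB
    have hr := hU.1 F (by simp [hF])
    replace ih := @ih hI.2 hU.2
    have hcard := hI.2.card_succ
    -- left rules apply at basic goals only, and cannot make them provable
    have left {A : Formula L} {Γ : Multiset (Formula L)} (hΓ₁ : s₁.ante = A ::ₘ Γ)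
        (hF₁ : s₁.succ = {F}) (hnr : ¬ r.Introduces F) (hsub : ∀ B ∈ Γ, B ∈ s.ante)
        (hA : Tame p a b G A) (hAF : F.IsBasic → F ∉ s.ante → A ≠ F) : False := by
      have hFb : F.IsBasic := hr.elim .inr fun hr => hr.elim .inl fun h => absurd h hnr
      refine ih hF₁ ?_ ?_
      · rw [hΓ₁]
        intro B hB
        rcases Multiset.mem_cons.1 hB with rfl | hB
        · exact hA
        · exact hΓ _ (hsub _ hB)
      · refine .of_basic ((hB.basic hG hFb).imp id ?_)
        rintro ⟨s, t, hst, hn⟩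
        refine ⟨s, t, hst, ?_⟩
        rw [hΓ₁, Multiset.mem_cons, not_or]
        exact ⟨(hAF hFb hn).symm, fun h => hn (hsub _ h)⟩
    cases h with
    | contrL B Γ Θ =>
      exact left rfl hF (by cases F <;> exact id) (fun _ h => h) (hΓ B (by simp))
        fun _ hn h => hn (by simp [h])
    | contrR B Γ Θ => simp at hcard
    | botR D Γ Θ =>
      obtain ⟨rfl, rfl⟩ := cons_eq_singleton hF
      exact ih rfl hΓ (.inl rfl)
    | andL_left B D Γ Θ => exact not_tame_and (hΓ (.and B D) (by simp))
    | andL_right B D Γ Θ => exact not_tame_and (hΓ (.and B D) (by simp))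
    | orR_left B D Γ Θ =>
      obtain ⟨rfl, rfl⟩ := cons_eq_singleton hF
      exact ih rfl hΓ (hB.or_inv hG).1
    | orR_right B D Γ Θ =>
      obtain ⟨rfl, rfl⟩ := cons_eq_singleton hF
      exact ih rfl hΓ (hB.or_inv hG).2
    | impR B D Γ Θ =>
      obtain ⟨rfl, rfl⟩ := cons_eq_singleton hF
      obtain ⟨h₁, h₂⟩ := hB.imp_inv hG
      refine ih rfl (fun A hA => ?_) h₂
      rcases Multiset.mem_cons.1 hA with rfl | hA
      · exact h₁
      · exact hΓ A hA
    | allL B t Γ Θ =>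
      have hch := (hΓ (.all B) (by simp)).all_inv
      exact left rfl hF (by cases F <;> exact id) (fun _ h => by simp [h]) (.inst hch t)
        fun hb _ h => hch.not_isBasic_inst t (h ▸ hb)
    | exR B t Γ Θ =>
      obtain ⟨rfl, rfl⟩ := cons_eq_singleton hF
      exact ih rfl hΓ (hB.ex_inv hG t)
    | exL B c Γ Θ hc =>
      obtain ⟨s, rfl⟩ := (hΓ (.ex B) (by simp)).ex_inv
      refine left rfl hF (by cases F <;> exact id) (fun _ h => by simp [h])
        (by rw [exInner_inst]; exact .atom _ _) fun _ _ h => ?_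
      rw [exInner_inst] at h
      -- The atom added by `∃`-L contains the eigenconstant, so it differs from the goal.
      exact hc.2 F (by simp_all) (h ▸ hasConst_atom_right p c s)
    | allR B c Γ Θ hc =>
      obtain ⟨rfl, rfl⟩ := cons_eq_singleton hF
      exact ih rfl hΓ (hB.all_inv hG hc.1)
  | two r h d₁ d₂ ih₁ ih₂ =>
    intro hB
    have hr := hU.1 F (by simp [hF])
    replace ih₁ := @ih₁ hI.2.1 hU.2.1
    replace ih₂ := @ih₂ hI.2.2 hU.2.2
    have hcard := hI.2.1.card_succ
    cases h with
    | orL B D Γ Θ =>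
      have hFb : F.IsBasic := hr.elim .inr fun hr => hr.elim .inl fun h => by cases F <;> cases h
      obtain ⟨s, rfl, rfl⟩ := (hΓ (.or B D) (by simp)).or_inv
      have hcons {t : Tm L 0} : ∀ A ∈ UniformProv.atom p s t ::ₘ Γ, Tame p a b G A := by
        intro A hA
        rcases Multiset.mem_cons.1 hA with rfl | hA
        · exact .atom _ _
        · exact hΓ A (by simp [hA])
      rcases hB.basic hG hFb with rfl | ⟨s', t', rfl, hn⟩
      · exact ih₁ hF hcons (.inl rfl)
      · simp only [Multiset.mem_cons, not_or] at hn
        -- Since `a ≠ b`, the goal atom differs from at least one of the two disjuncts; follow that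
        -- branch.
        by_cases ha : t' = a.term
        · refine ih₂ hF hcons (.of_basic (.inr ⟨s', t', rfl, ?_⟩))
          rw [Multiset.mem_cons, not_or, atom_inj]
          refine ⟨fun h => hab ?_, hn.2⟩
          have := ha.symm.trans h.2
          simpa [Constants.term] using this
        · refine ih₁ hF hcons (.of_basic (.inr ⟨s', t', rfl, ?_⟩))
          rw [Multiset.mem_cons, not_or, atom_inj]
          exact ⟨fun h => ha h.2, hn.2⟩
    | andR B D Γ Θ =>
      obtain ⟨rfl, rfl⟩ := cons_eq_singleton hF
      exact Blocked.not_and hG hB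
    | impL B D Γ Θ Ξ =>
      have hΘ : Θ = 0 := by simpa using hcard
      subst hΘ
      -- The only implication available is `G ⊃ ⊥`, whose left premise has the blocked goal `G`.
      exact ih₁ rfl (fun A hA => hΓ A (by simp [hA]))
        (.inr (.inl (hΓ (.imp B D) (by simp)).imp_inv))

end Blocked

/-! ### The necessity of the conditions -/

/-- Existence of an **I**-proof in which exactly the rules in `R` are used. -/
def IProv (R : Set Rule) (Γ : Multiset (Formula L)) (F : Formula L) : Prop :=
  ∃ d : Deriv (⟨Γ, {F}⟩ : Sequent L), d.IsI ∧ d.rules = R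

theorem IProv.ax {Γ : Multiset (Formula L)} {F : Formula L} (hF : F.IsBasic) :
    IProv ∅ (F ::ₘ Γ) F :=
  ⟨.ax (.inr ⟨F, hF, Multiset.mem_cons_self _ _, Multiset.mem_singleton_self _⟩), rfl, rfl⟩

theorem IProv.one {R : Set Rule} {r : Rule} {Γ Γ' : Multiset (Formula L)} {F F' : Formula L}
    (h : Step1 r ⟨Γ', F' ::ₘ 0⟩ ⟨Γ, F ::ₘ 0⟩) (p : IProv R Γ' F') : IProv (insert r R) Γ F := by
  obtain ⟨d, hI, rfl⟩ := p
  exact ⟨.one r h d, ⟨rfl, hI⟩, rfl⟩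

theorem IProv.two {R₁ R₂ : Set Rule} {r : Rule} {Γ Γ₁ Γ₂ : Multiset (Formula L)}
    {F F₁ F₂ : Formula L} (h : Step2 r ⟨Γ₁, F₁ ::ₘ 0⟩ ⟨Γ₂, F₂ ::ₘ 0⟩ ⟨Γ, F ::ₘ 0⟩)
    (p₁ : IProv R₁ Γ₁ F₁) (p₂ : IProv R₂ Γ₂ F₂) : IProv (insert r (R₁ ∪ R₂)) Γ F := by
  obtain ⟨d₁, hI₁, rfl⟩ := p₁
  obtain ⟨d₂, hI₂, rfl⟩ := p₂
  exact ⟨.two r h d₁ d₂, ⟨rfl, hI₁, hI₂⟩, rfl⟩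

section Necessity

variable (p : L.Relations 2) (a b : L.Constants)

theorem iProv_orBody_orBody (Γ : Multiset (Formula L)) (s : Tm L 0) :
    IProv {.orL, .orR} ((orBody p a b).inst s ::ₘ Γ) ((orBody p a b).inst s) := by
  rw [orBody_inst]
  have := IProv.two (.orL _ _ Γ _)
    (.one (.orR_left _ (atom p s b.term) _ 0) (.ax (isBasic_atom p s a.term)))
    (.one (.orR_right (atom p s a.term) _ _ 0) (.ax (isBasic_atom p s b.term)))
  simpa using this

theorem iProv_orBody_exBody (Γ : Multiset (Formula L)) (s : Tm L 0) :
    IProv {.orL, .exR} ((orBody p a b).inst s ::ₘ Γ) ((exBody p).inst s) := by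
  rw [orBody_inst, exBody_inst]
  have ex (t : Tm L 0) : IProv {.exR} (atom p s t ::ₘ Γ) (.ex (exInner p s)) := by
    have : IProv ∅ (atom p s t ::ₘ Γ) ((exInner p s).inst t) := by
      rw [exInner_inst]
      exact .ax (isBasic_atom p s t)
    simpa using IProv.one (.exR _ t _ 0) this
  simpa using IProv.two (.orL _ _ Γ _) (ex a.term) (ex b.term)

theorem iProv_exBody_exBody [Infinite L.Constants] (Γ : Multiset (Formula L)) (s : Tm L 0) :
    IProv {.exL, .exR} ((exBody p).inst s ::ₘ Γ) ((exBody p).inst s) := by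
  rw [exBody_inst]
  obtain ⟨c, hc⟩ := Sequent.exists_fresh
    (⟨.ex (exInner p s) ::ₘ Γ, {.ex (exInner p s)}⟩ : Sequent L)
  have h : IProv ∅ ((exInner p s).inst c.term ::ₘ Γ) ((exInner p s).inst c.term) := by
    rw [exInner_inst]
    exact .ax (isBasic_atom p s _)
  simpa using IProv.one (.exL _ c Γ _ hc) (IProv.one (.exR _ c.term _ 0) h)

variable {p a b}

/-- `Y` decides how `H(c)` enters the context after `∀`-R: by `∀`-L from an assumption `∀ x, H(x)`,
or by `⊃`-R from the goal. -/
theorem exists_not_isO [Infinite L.Constants] (hab : a ≠ b) {H K : Fml L 1} {X : Set Rule}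
    (hH : IsChoice p a b H) (hK : IsChoice p a b K)
    (hX : ∀ Γ s, IProv X (H.inst s ::ₘ Γ) (K.inst s)) {Y : Rule} (hY : Y = .allL ∨ Y = .impR) :
    ∃ (Γ : Multiset (Formula L)) (G : Formula L) (d : Deriv (augmented Γ G)),
      d.IsI ∧ d.rules = insert .allR (insert Y X) ∧ ¬ ∃ d' : Deriv (augmented Γ G), d'.IsO := by
  have notO {Γ : Multiset (Formula L)} {G : Formula L} (hG : IsGoal p a b G)
      (hΓ : ∀ A ∈ Γ, Tame p a b G A) : ¬ ∃ d' : Deriv (augmented Γ G), d'.IsO := by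
    rintro ⟨d, hI, hU⟩
    refine not_blocked_of_isUniform hab hG d hI hU rfl (fun A hA => ?_) (.inr (.inl rfl))
    rcases Multiset.mem_cons.1 hA with rfl | hA
    · exact .inl rfl
    · exact hΓ A hA
  suffices ∃ Γ G, IProv (insert .allR (insert Y X)) (.imp G .bot ::ₘ Γ) G ∧
      IsGoal p a b G ∧ ∀ A ∈ Γ, Tame p a b G A by
    obtain ⟨Γ, G, ⟨d, hI, hd⟩, hG, hΓ⟩ := this
    exact ⟨Γ, G, d, hI, hd, notO hG hΓ⟩
  rcases hY with rfl | rfl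
  · refine ⟨{.all H}, .all K, ?_, ⟨K, hK, .inl rfl⟩, fun A hA => ?_⟩
    · obtain ⟨c, hc⟩ := Sequent.exists_fresh (augmented {.all H} (.all K))
      refine .one (.allR K c _ 0 hc) ?_
      have := IProv.one (.allL H c.term {.imp (.all K) .bot} _) (hX _ c.term)
      rwa [← Multiset.cons_zero, Multiset.cons_swap] at this
    · exact .inr (.inl ⟨H, hH, Multiset.mem_singleton.1 hA⟩)
  · refine ⟨0, .all (.imp H K), ?_, ⟨K, hK, .inr ⟨H, hH, rfl⟩⟩, fun A hA => by simp at hA⟩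
    obtain ⟨c, hc⟩ := Sequent.exists_fresh (augmented 0 (.all (.imp H K)))
    exact .one (.allR (.imp H K) c _ 0 hc) (.one (.impR _ _ _ 0) (hX _ c.term))

theorem exists_not_isO_of_not_restr [Infinite L.Constants] (p : L.Relations 2) {U : Set Rule}
    (h₁ : ¬ Restr1 U) (h₂ : ¬ Restr2 U) (h₃ : ¬ Restr3 U) :
    ∃ (Γ : Multiset (Formula L)) (G : Formula L) (d : Deriv (augmented Γ G)),
      d.IsI ∧ d.rules ⊆ U ∧ ¬ Restr1 d.rules ∧ ¬ Restr2 d.rules ∧ ¬ Restr3 d.rules ∧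
      ¬ ∃ d' : Deriv (augmented Γ G), d'.IsO := by
  obtain ⟨a, b, hab⟩ := exists_pair_ne L.Constants
  have hall : Rule.allR ∈ U := not_not.1 h₁
  obtain ⟨Y, hYU, hY⟩ : ∃ Y, Y ∈ U ∧ (Y = .allL ∨ Y = .impR) := by
    by_contra! h
    exact h₃ ⟨fun hU => (h _ hU).1 rfl, fun hU => (h _ hU).2 rfl⟩
  have hor : IsChoice p a b (orBody p a b) := .inl rfl
  have hex : IsChoice p a b (exBody p) := .inr rfl
  -- `X` is a pair of rules violating the second restriction, and `H`, `K` are chosen so that `K(s)`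
  -- follows from `H(s)` by exactly these rules. All supersets `V` are considered because `∀`-R and
  -- `Y` are added later.
  obtain ⟨X, H, K, hXU, hX₂, hH, hK, hX⟩ : ∃ (X : Set Rule) (H K : Fml L 1), X ⊆ U ∧
      (∀ V, X ⊆ V → ¬ Restr2 V) ∧ IsChoice p a b H ∧ IsChoice p a b K ∧
      ∀ Γ s, IProv X (H.inst s ::ₘ Γ) (K.inst s) := by
    simp only [Restr2, not_and_or, not_or, not_not] at h₂
    rcases h₂ with ⟨hR, hL⟩ | ⟨hR, hL | hL⟩
    · exact ⟨{.orL, .orR}, _, _, by simp [Set.insert_subset_iff, *],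
        fun V hV h => by simp_all [Set.insert_subset_iff, Restr2], hor, hor,
        iProv_orBody_orBody p a b⟩
    · exact ⟨{.orL, .exR}, _, _, by simp [Set.insert_subset_iff, *],
        fun V hV h => by simp_all [Set.insert_subset_iff, Restr2], hor, hex,
        iProv_orBody_exBody p a b⟩
    · exact ⟨{.exL, .exR}, _, _, by simp [Set.insert_subset_iff, *],
        fun V hV h => by simp_all [Set.insert_subset_iff, Restr2], hex, hex,
        iProv_exBody_exBody p⟩
  obtain ⟨Γ, G, d, hI, hd, hO⟩ := exists_not_isO hab hH hK hX hY
  refine ⟨Γ, G, d, hI, ?_, ?_, ?_, ?_, hO⟩ <;> rw [hd]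
  · exact Set.insert_subset hall (Set.insert_subset hYU hXU)
  · exact fun h => h (.inl rfl)
  · exact hX₂ _ ((Set.subset_insert _ _).trans (Set.subset_insert _ _))
  · rcases hY with rfl | rfl
    · exact fun h => h.1 (.inr (.inl rfl))
    · exact fun h => h.2 (.inr (.inl rfl))

end Necessity

end UniformProv

theorem mainTheorem4 (L : FirstOrder.Language.{u, v}) [Infinite L.Constants] :
    (∀ (Γ : Multiset (UniformProv.Formula L)) (G : UniformProv.Formula L)
      (d : UniformProv.Deriv (UniformProv.augmented Γ G)), d.IsI →
      (UniformProv.Restr1 d.rules ∨ UniformProv.Restr2 d.rules ∨ UniformProv.Restr3 d.rules) →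
      ∃ d' : UniformProv.Deriv (UniformProv.augmented Γ G), d'.IsO) ∧
    (Nonempty (L.Relations 2) →
      ∀ U : Set UniformProv.Rule,
        ¬ UniformProv.Restr1 U → ¬ UniformProv.Restr2 U → ¬ UniformProv.Restr3 U →
        ∃ (Γ : Multiset (UniformProv.Formula L)) (G : UniformProv.Formula L)
          (d : UniformProv.Deriv (UniformProv.augmented Γ G)),
          d.IsI ∧ d.rules ⊆ U ∧
          ¬ UniformProv.Restr1 d.rules ∧ ¬ UniformProv.Restr2 d.rules ∧
          ¬ UniformProv.Restr3 d.rules ∧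
          ¬ ∃ d' : UniformProv.Deriv (UniformProv.augmented Γ G), d'.IsO) := by
  exact ⟨fun _ _ d hI h => UniformProv.exists_isO_of_restr d hI h,
    fun ⟨p⟩ _ h₁ h₂ h₃ => UniformProv.exists_not_isO_of_not_restr p h₁ h₂ h₃⟩
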